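/- Let $m\ge 0$ and let $C=(C_{i,j})$ be a symmetric $m\times m$ matrix of non-negative integers (a symmetric quiver with $m$ vertices and $C_{i,j}$ arrows from $i$ to $j$). Put $(q^2;q^2)_d=\prod_{k=1}^{d}(1-q^{2k})$ and let $$P_C(x_1,\dots,x_m)=\sum_{d_1,\dots,d_m\ge 0}\frac{(-q)^{\sum_{i,j}C_{i,j}d_id_j}}{(q^2;q^2)_{d_1}\cdots(q^2;q^2)_{d_m}}\,x_1^{d_1}\cdots x_m^{d_m}$$ be its motivic generating series. A set of pairs $(i_u,j_u)\in\{1,\dots,m\}^2$ is called admissible if its second entries $j_u$ are pairwise distinct and it contains no cycle, i.e. no distinct pairs $(i_1,j_1),\dots,(i_r,j_r)$, $r\ge1$, with $j_s=i_{s+1}$ for $s<r$ and $j_r=i_1$. Define the polynomials $$A(l_1,\dots,l_m)=1+\sum_{k=1}^{m-1}\ \sum_{\substack{\Sigma\text{ admissible}\\|\Sigma|=k}}\ \prod_{(i,j)\in\Sigma}C_{i,j}l_i,\qquad A_{\max}(l_1,\dots,l_m)=\sum_{\substack{\Sigma\text{ admissible}\\|\Sigma|=m-1}}\ \prod_{(i,j)\in\Sigma}C_{i,j}l_i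 .$$ (For $m=0$ the number $m-1$ is read as $0$.) Then: 1. The limit $y(x_1,\dots,x_m)=\lim_{q\to1}P_C(q^2x_1,\dots,q^2x_m)/P_C(x_1,\dots,x_m)$ exists coefficientwise, is a formal power series with constant term $1$, and $$\log y(x_1,\dots,x_m)=\sum_{l\ne 0}c_l\,x^l,\qquad c_l=(-1)^{\sum_i(C_{i,i}+1)l_i}\,A_{\max}(l_1,\dots,l_m)\prod_{j=1}^m\frac{1}{\sum_iC_{i,j}l_i}\binom{\sum_iC_{i,j}l_i}{l_j},$$ the sum being over $l=(l_1,\dots,l_m)\in\mathbb Z_{\ge0}^m\setminus\{0\}$. If some $\sum_iC_{i,j}l_i$ is $0$, the expression for $c_l$ is understood by continuity in the entries of the matrix: $c_l$ is the limit, which exists, of the sign $(-1)^{\sum_i(C_{i,i}+1)l_i}$ times the expression $A_{\max}(l)\prod_j\frac{1}{\sum_iM_{i,j}l_i}\binom{\sum_iM_{i,j}l_i}{l_j}$ formed with a real matrix $M$ in place of $C$, as $M\to C$ through matrices with $\sum_iM_{i,j}l_i\neq0$ for all $j$. 2. The largest size of an admissible set is $m-1$. The polynomial $A$ has degree at most $m-1$,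 and $A_{\max}$ is its homogeneous part of degree $m-1$. 3. There are integers $\Omega_d$ ($d\in\mathbb Z_{\ge0}^m\setminus\{0\}$), the numerical Donaldson–Thomas invariants, with $y=\prod_{d\ne0}(1-x^d)^{\Omega_d}$, and for any such family $$\Omega_d=-\sum_{n\mid\gcd(d_1,\dots,d_m)}\frac{\mu(n)}{n}\,c_{d/n}\qquad\text{for all }d\neq0,$$ where $\mu$ is the Möbius function. -/

import Mathlib

open Filter Topology Finset
open scoped MvPowerSeries.WithPiTopology

namespace SymmetricQuiver

noncomputable section

/-- The `q`-Pochhammer symbol `(a; q)_n = ∏_{k < n} (1 - a q ^ k)`. -/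
def qPochhammer (a q : ℝ) (n : ℕ) : ℝ :=
  ∏ k ∈ range n, (1 - a * q ^ k)

/-- The motivic generating series
`P_C(x) = ∑_d (-q) ^ (∑_{i,j} C_{ij} d_i d_j) / ∏_i (q²; q²)_{d_i} * x ^ d`
of the quiver with `C i j` arrows from `i` to `j`, at a real value of `q`. -/
def motivicSeries {m : ℕ} (C : Matrix (Fin m) (Fin m) ℕ) (q : ℝ) : MvPowerSeries (Fin m) ℝ :=
  fun d => (-q) ^ (∑ i, ∑ j, C i j * d i * d j) / ∏ i, qPochhammer (q ^ 2) (q ^ 2) (d i)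

/-- The quotient `P_C(q² x_1, …, q² x_m) / P_C(x_1, …, x_m)`. The divisor has constant term `1`,
so it is invertible as a power series. -/
def quotientSeries {m : ℕ} (C : Matrix (Fin m) (Fin m) ℕ) (q : ℝ) : MvPowerSeries (Fin m) ℝ :=
  MvPowerSeries.rescale (fun _ => q ^ 2) (motivicSeries C q) * (motivicSeries C q)⁻¹

/-- `y` is the coefficientwise limit of the quotient series as `q → 1`, `q ≠ 1`. -/
def IsClassicalLimit {m : ℕ} (C : Matrix (Fin m) (Fin m) ℕ) (y : MvPowerSeries (Fin m) ℝ) : Prop :=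
  ∀ l : Fin m →₀ ℕ,
    Tendsto (fun q : ℝ => MvPowerSeries.coeff l (quotientSeries C q)) (𝓝[≠] 1)
      (𝓝 (MvPowerSeries.coeff l y))

/-- The formal logarithm `log (1 + (y - 1)) = ∑_{k ≥ 1} (-1) ^ (k + 1) (y - 1) ^ k / k` of a series
`y` with constant term `1`. -/
def logSeries {m : ℕ} (y : MvPowerSeries (Fin m) ℝ) : MvPowerSeries (Fin m) ℝ :=
  (PowerSeries.log ℝ).subst (y - 1)

/-- A set of pairs is admissible if no two of its pairs have the same second entry and it has no
cycle: there is no sequence of `n + 1 ≥ 1` distinct pairs in it such that the second entry of each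
is the first entry of the next one, cyclically (addition in `Fin (n + 1)` is cyclic). -/
def IsAdmissible {m : ℕ} (S : Finset (Fin m × Fin m)) : Prop :=
  (∀ p ∈ S, ∀ p' ∈ S, p.2 = p'.2 → p = p') ∧
  ∀ (n : ℕ) (f : Fin (n + 1) → Fin m × Fin m), Function.Injective f → (∀ t, f t ∈ S) →
    ¬ ∀ t, (f t).2 = (f (t + 1)).1

open Classical in
/-- The admissible sets of `k` pairs. -/
def admissibleSets (m k : ℕ) : Finset (Finset (Fin m × Fin m)) :=
  {S | IsAdmissible S ∧ S.card = k}

/-- The polynomial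
`A(l_1, …, l_m) = 1 + ∑_{k=1}^{m-1} ∑_{admissible S, |S| = k} ∏_{(i,j) ∈ S} M_{ij} l_i`. -/
def polyA {m : ℕ} (M : Matrix (Fin m) (Fin m) ℝ) : MvPolynomial (Fin m) ℝ :=
  1 + ∑ k ∈ Finset.Icc 1 (m - 1), ∑ S ∈ admissibleSets m k,
    ∏ p ∈ S, MvPolynomial.C (M p.1 p.2) * MvPolynomial.X p.1

/-- The polynomial
`A_max(l_1, …, l_m) = ∑_{admissible S, |S| = m - 1} ∏_{(i,j) ∈ S} M_{ij} l_i`. -/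
def polyAmax {m : ℕ} (M : Matrix (Fin m) (Fin m) ℝ) : MvPolynomial (Fin m) ℝ :=
  ∑ S ∈ admissibleSets m (m - 1), ∏ p ∈ S, MvPolynomial.C (M p.1 p.2) * MvPolynomial.X p.1

/-- `A_max(l_1, …, l_m)` as a number. -/
def Amax {m : ℕ} (M : Matrix (Fin m) (Fin m) ℝ) (l : Fin m →₀ ℕ) : ℝ :=
  MvPolynomial.eval (fun i => (l i : ℝ)) (polyAmax M)

/-- The linear form `∑_i M_{ij} l_i`. -/
def linForm {m : ℕ} (M : Matrix (Fin m) (Fin m) ℝ) (l : Fin m →₀ ℕ) (j : Fin m) : ℝ :=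
  ∑ i, M i j * (l i : ℝ)

/-- `A_max(l) ∏_j (1 / ∑_i M_{ij} l_i) * binom (∑_i M_{ij} l_i, l_j)` for a matrix `M` of real
numbers (`Ring.choose` is the binomial coefficient with arbitrary upper entry). It is used only
where all the linear forms are nonzero. -/
def unsignedTerm {m : ℕ} (M : Matrix (Fin m) (Fin m) ℝ) (l : Fin m →₀ ℕ) : ℝ :=
  Amax M l * ∏ j, (1 / linForm M l j * Ring.choose (linForm M l j) (l j))

/-- The filter of neighbourhoods of `C` within the set of real matrices at which no denominator of
`unsignedTerm` vanishes. -/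
def regularNhds {m : ℕ} (C : Matrix (Fin m) (Fin m) ℕ) (l : Fin m →₀ ℕ) :
    Filter (Matrix (Fin m) (Fin m) ℝ) :=
  𝓝[{M | ∀ j, linForm M l j ≠ 0}] (C.map (fun n : ℕ => (n : ℝ)))

/-- `∑_i (C_{ii} + 1) l_i`, the exponent of the sign. -/
def signExponent {m : ℕ} (C : Matrix (Fin m) (Fin m) ℕ) (l : Fin m →₀ ℕ) : ℕ :=
  ∑ i, (C i i + 1) * l i

/-- The explicit coefficient of `x ^ l`, where a vanishing denominator is resolved by
continuity in the entries of the matrix. -/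
def logCoeff {m : ℕ} (C : Matrix (Fin m) (Fin m) ℕ) (l : Fin m →₀ ℕ) : ℝ :=
  (-1) ^ signExponent C l * limUnder (regularNhds C l) (fun M => unsignedTerm M l)

/-- The power series `(1 - x ^ d) ^ n` for a nonzero exponent vector `d` and an integer `n`. -/
def eulerFactor {m : ℕ} (d : Fin m →₀ ℕ) (n : ℤ) : MvPowerSeries (Fin m) ℝ :=
  (1 - MvPowerSeries.monomial d 1) ^ n.toNat * ((1 - MvPowerSeries.monomial d 1)⁻¹) ^ (-n).toNat

/-- `Ω` is the family of numerical Donaldson-Thomas invariants read off from `y`: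
`y = ∏_{d ≠ 0} (1 - x ^ d) ^ Ω_d`. -/
def IsDTFamily {m : ℕ} (y : MvPowerSeries (Fin m) ℝ) (Ω : {d : Fin m →₀ ℕ // d ≠ 0} → ℤ) : Prop :=
  HasProd (fun d : {d : Fin m →₀ ℕ // d ≠ 0} => eulerFactor d.1 (Ω d)) y

/-- The entrywise (truncated) quotient `l / n`; it is used only when `n` divides every entry. -/
def divVec {m : ℕ} (l : Fin m →₀ ℕ) (n : ℕ) : Fin m →₀ ℕ :=
  l.mapRange (fun a => a / n) (Nat.zero_div n)

end

end SymmetricQuiver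

/-! Write P(q^{2c}x) for the series with x_i replaced by q^{2c_i}x_i. Comparing coefficients gives
the q-difference equation P(q^{2(c+e_j)}x) = P(q^{2c}x) - (-q)^{C_jj} q^{2c_j} x_j P(q^{2(c+C_j)}x),
where C_j is the j-th row. Divided by P(x), it determines all quotients P(q^{2c}x)/P(x) from the
case c = 0, by induction on the degree and on c.

At q = 1 the recursion has an explicit solution: up to sign, the coefficient at x^l is the
determinant with entries δ_ij binom(s_i, l_i) - binom(s_i - 1, l_i - 1) C_ij, where s_i = c_i + ∑_k
C_ki l_k. Pascal's rule in row j is the recursion (`det_lagrangeMatrix_add_single`), and for c = 0,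
l ≠ 0 the vector l lies in the kernel (`det_lagrangeMatrix_eq_zero`). Hence the limit exists
(`tendsto_coeff_shiftedQuotient`) and its coefficients are integers.

The limit is multiplicative in c (`limitSeries_add`), so c = (a, …, a) yields y^a. Its coefficients
are therefore polynomials in a, and their linear terms are the coefficients of log y
(`coeff_one_powPolynomial`). Multiplying row i by s_i = a + ∑_k C_ki l_k turns the determinant into
∏ binom(s_i, l_i) times the determinant of a plus a weighted Laplacian, which the matrix-tree
theorem (`det_add_laplacian`) expands over rooted forests. The forests with m - 1 edges give the
linear term, namely A_max. The polynomial in a depends continuously on the matrix even where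
denominators vanish, which gives the limit by continuity.

An integral series with constant term 1 is a product of integer powers of 1 - x^d, obtained degree
by degree (`exists_isDTFamily`). Taking logarithms and applying Möbius inversion along the multiples
of a primitive vector gives Ω (`isDTFamily_eq_moebius_sum`). -/

namespace SymmetricQuiver

/-! ### The Lagrange inversion determinant and its recursion -/

section Determinant

variable {R : Type*} [CommRing R] [BinomialRing R] {ι : Type*} [Fintype ι] [DecidableEq ι]

/-- The binomial coefficient `binom (s - 1, n - 1)`, which is `0` for `n = 0`. -/
def choosePred (s : R) : ℕ → R
  | 0 => 0
  | n + 1 => Ring.choose (s - 1) n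

lemma choose_add_one (s : R) (n : ℕ) :
    Ring.choose (s + 1) (n + 1) = Ring.choose s (n + 1) + Ring.choose s n := by
  rw [Ring.choose_succ_succ, add_comm]

lemma choosePred_add_one (s : R) (n : ℕ) :
    choosePred (s + 1) (n + 1) = choosePred s (n + 1) + choosePred s n := by
  cases n with
  | zero => simp [choosePred]
  | succ n =>
    have := choose_add_one (s - 1) n
    simpa [choosePred] using this

/-- The absorption identity. It comes from factoring s out of the falling factorial; n! is cancelled
because a binomial ring is torsion-free. -/
lemma natCast_mul_choose (s : R) (n : ℕ) :
    (n : R) * Ring.choose s n = s * choosePred s n := by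
  cases n with
  | zero => simp [choosePred]
  | succ n =>
    have := BinomialRing.toIsAddTorsionFree (R := R)
    apply nsmul_right_injective (Nat.factorial_ne_zero n)
    have h1 := Ring.descPochhammer_eq_factorial_smul_choose s (n + 1)
    have h2 := Ring.descPochhammer_eq_factorial_smul_choose (s - 1) n
    have h3 : (descPochhammer ℤ (n + 1)).smeval s = s * (descPochhammer ℤ n).smeval (s - 1) := by
      rw [descPochhammer_succ_left, Polynomial.smeval_X_mul, Polynomial.smeval_comp]
      simp [Polynomial.smeval_sub, Polynomial.smeval_X, Polynomial.smeval_one]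
    rw [h3, h2, Nat.factorial_succ] at h1
    simp only [choosePred, nsmul_eq_mul] at h1 ⊢
    push_cast at h1 ⊢
    linear_combination -h1

/-- The matrix whose determinant is the Lagrange inversion coefficient. -/
def lagrangeMatrix (M : Matrix ι ι R) (s : ι → R) (l : ι → ℕ) : Matrix ι ι R :=
  fun i j => (if i = j then Ring.choose (s i) (l i) else 0) - choosePred (s i) (l i) * M i j

/-- Only row j involves s_j and l_j, and by Pascal's rule that row is a sum of two rows of the same
shape; the determinant is additive in it. -/
lemma det_lagrangeMatrix_add_single (M : Matrix ι ι R) (s : ι → R) (l l' : ι → ℕ) (j : ι)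
    (hl : l = l' + Pi.single j 1) :
    (lagrangeMatrix M (s + Pi.single j 1) l).det =
      (lagrangeMatrix M s l).det + (lagrangeMatrix M s l').det := by
  have e1 : lagrangeMatrix M (s + Pi.single j 1) l = (lagrangeMatrix M s l).updateRow j
      (lagrangeMatrix M s l j + lagrangeMatrix M s l' j) := by
    ext i k
    by_cases h : i = j
    · subst h
      simp only [hl, lagrangeMatrix, Matrix.updateRow_self, Pi.add_apply, Pi.single_eq_same,
        choose_add_one, choosePred_add_one]
      split_ifs <;> ring
    · simp [Matrix.updateRow_ne h, lagrangeMatrix, Pi.single_eq_of_ne h]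
  have e2 : lagrangeMatrix M s l' =
      (lagrangeMatrix M s l).updateRow j (lagrangeMatrix M s l' j) := by
    ext i k
    by_cases h : i = j
    · subst h; simp
    · simp [Matrix.updateRow_ne h, lagrangeMatrix, Pi.single_eq_of_ne h, hl]
  rw [e1, Matrix.det_updateRow_add, Matrix.updateRow_eq_self, ← e2]

lemma det_lagrangeMatrix_add_single_of_eq_zero (M : Matrix ι ι R) (s : ι → R) (l : ι → ℕ) (j : ι)
    (hl : l j = 0) :
    (lagrangeMatrix M (s + Pi.single j 1) l).det = (lagrangeMatrix M s l).det := by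
  congr 1
  ext i k
  by_cases h : i = j
  · subst h; simp [lagrangeMatrix, hl, choosePred]
  · simp [lagrangeMatrix, Pi.single_eq_of_ne h]

lemma det_lagrangeMatrix_zero (M : Matrix ι ι R) (s : ι → R) :
    (lagrangeMatrix M s 0).det = 1 := by
  have : lagrangeMatrix M s 0 = 1 := by
    ext i k
    simp [lagrangeMatrix, choosePred, Matrix.one_apply]
  rw [this, Matrix.det_one]

/-- The nonzero vector l is in the kernel: row i applied to l gives l_i binom(s_i, l_i) - s_i
binom(s_i - 1, l_i - 1), which vanishes by absorption. -/
lemma det_lagrangeMatrix_eq_zero [IsDomain R] [CharZero R] (M : Matrix ι ι R) (s : ι → R)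
    (l : ι → ℕ) (hl : l ≠ 0) (h : ∀ i, ∑ j, M i j * l j = s i) :
    (lagrangeMatrix M s l).det = 0 := by
  rw [← Matrix.exists_mulVec_eq_zero_iff]
  refine ⟨fun i => (l i : R), ?_, ?_⟩
  · intro h0
    apply hl
    ext i
    have := congrFun h0 i
    simpa using this
  · ext i
    have h1 := natCast_mul_choose (s i) (l i)
    have h2 : ∑ x, choosePred (s i) (l i) * M i x * (l x : R) = choosePred (s i) (l i) * s i := by
      rw [← h i, Finset.mul_sum]
      exact Finset.sum_congr rfl fun _ _ => by ring
    simp only [Matrix.mulVec, dotProduct, lagrangeMatrix, sub_mul, Finset.sum_sub_distrib, h2,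
      ite_mul, zero_mul, Finset.sum_ite_eq, Finset.mem_univ, if_true, Pi.zero_apply]
    linear_combination h1

lemma map_choosePred {S : Type*} [CommRing S] [BinomialRing S] (f : R →+* S) (s : R) (n : ℕ) :
    f (choosePred s n) = choosePred (f s) n := by
  cases n with
  | zero => simp [choosePred]
  | succ n => simp [choosePred, Ring.map_choose]

/-- Needed for ℤ → ℝ, where it gives integrality, and for the evaluations ℝ[X] → ℝ, where it
specialises the exponent a. -/
lemma map_det_lagrangeMatrix {S : Type*} [CommRing S] [BinomialRing S] (f : R →+* S)
    (M : Matrix ι ι R) (s : ι → R) (l : ι → ℕ) :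
    f (lagrangeMatrix M s l).det = (lagrangeMatrix (M.map f) (fun i => f (s i)) l).det := by
  rw [RingHom.map_det]
  congr 1
  ext i j
  simp only [lagrangeMatrix, RingHom.mapMatrix_apply, Matrix.map_apply, map_sub, map_mul,
    map_choosePred]
  split_ifs <;> simp [Ring.map_choose]

end Determinant

/-! ### The q-difference equation and its limit as q → 1 -/

section ClassicalLimit

variable {m : ℕ}

/-- The real matrix with the entries of `C`. -/
abbrev realMatrix (C : Matrix (Fin m) (Fin m) ℕ) : Matrix (Fin m) (Fin m) ℝ :=
  C.map (fun n : ℕ => (n : ℝ))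

/-- The coefficient of `t ^ l` in `∏ y_i ^ (c_i)` for the solution of
`y_j = 1 + t_j ∏ y_i ^ (C_{ij})`. -/
noncomputable def lagrangeCoeff (C : Matrix (Fin m) (Fin m) ℕ) (c : Fin m → ℕ)
    (l : Fin m →₀ ℕ) : ℝ :=
  (lagrangeMatrix (realMatrix C) (fun i => (c i : ℝ) + linForm (realMatrix C) l i) l).det

lemma lagrangeCoeff_zero_right (C : Matrix (Fin m) (Fin m) ℕ) (c : Fin m → ℕ) :
    lagrangeCoeff C c 0 = 1 := by
  simpa [lagrangeCoeff] using det_lagrangeMatrix_zero _ _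

lemma lagrangeCoeff_zero_left (C : Matrix (Fin m) (Fin m) ℕ) (hC : C.IsSymm) (l : Fin m →₀ ℕ)
    (hl : l ≠ 0) : lagrangeCoeff C 0 l = 0 := by
  apply det_lagrangeMatrix_eq_zero
  · simpa using hl
  · intro i
    simp only [linForm, Matrix.map_apply, Pi.zero_apply, Nat.cast_zero, zero_add]
    -- The upper entries are column sums, while the kernel condition concerns rows; symmetry of C
    -- reconciles them.
    exact Finset.sum_congr rfl fun j _ => by rw [hC.apply j i]

lemma linForm_add_single (M : Matrix (Fin m) (Fin m) ℝ) (l : Fin m →₀ ℕ) (i j : Fin m) :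
    linForm M (l + Finsupp.single j 1) i = linForm M l i + M j i := by
  simp [linForm, mul_add, Finset.sum_add_distrib, Finsupp.single_apply]

lemma lagrangeCoeff_add_single (C : Matrix (Fin m) (Fin m) ℕ) (c : Fin m → ℕ)
    (l : Fin m →₀ ℕ) (j : Fin m) :
    lagrangeCoeff C (c + Pi.single j 1) (l + Finsupp.single j 1) =
      lagrangeCoeff C c (l + Finsupp.single j 1) + lagrangeCoeff C (c + C j) l := by
  unfold lagrangeCoeff
  have h := det_lagrangeMatrix_add_single (realMatrix C)
    (fun i => (c i : ℝ) + linForm (realMatrix C) (l + Finsupp.single j 1) i)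
    (l + Finsupp.single j 1 : Fin m →₀ ℕ) l j (by
      rw [Finsupp.coe_add, Finsupp.single_eq_pi_single])
  have e1 : (fun i => ((c + Pi.single j 1 : Fin m → ℕ) i : ℝ) +
        linForm (realMatrix C) (l + Finsupp.single j 1) i) =
      (fun i => (c i : ℝ) + linForm (realMatrix C) (l + Finsupp.single j 1) i) +
        Pi.single j 1 := by
    ext i
    simp only [Pi.add_apply, Nat.cast_add, Pi.single_apply]
    split_ifs <;> push_cast <;> ring
  -- Removing e_j from l lowers the i-th linear form by C_ji, which adding row j to c compensates:
  -- the upper entries are unchanged.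
  have e2 : (fun i => ((c + C j) i : ℝ) + linForm (realMatrix C) l i) =
      fun i => (c i : ℝ) + linForm (realMatrix C) (l + Finsupp.single j 1) i := by
    ext i
    simp only [Pi.add_apply, Nat.cast_add, linForm_add_single, Matrix.map_apply]
    ring
  rw [e1, e2]
  exact h

lemma lagrangeCoeff_add_single_of_eq_zero (C : Matrix (Fin m) (Fin m) ℕ) (c : Fin m → ℕ)
    (l : Fin m →₀ ℕ) (j : Fin m) (hl : l j = 0) :
    lagrangeCoeff C (c + Pi.single j 1) l = lagrangeCoeff C c l := by
  unfold lagrangeCoeff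
  rw [← det_lagrangeMatrix_add_single_of_eq_zero _ (fun i => (c i : ℝ) + _) _ j hl]
  congr 2
  ext i
  simp only [Pi.add_apply, Nat.cast_add, Pi.single_apply]
  split_ifs <;> push_cast <;> ring

lemma qPochhammer_succ (a q : ℝ) (n : ℕ) :
    qPochhammer a q (n + 1) = qPochhammer a q n * (1 - a * q ^ n) := by
  simp [qPochhammer, Finset.prod_range_succ]

lemma one_sub_pow_ne_zero {q : ℝ} (hq : 0 < q) (hq1 : q ≠ 1) (n : ℕ) :
    1 - q ^ 2 * (q ^ 2) ^ n ≠ 0 := by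
  have h : q ^ (2 * n + 2) ≠ 1 := fun h => hq1 ((pow_eq_one_iff_of_nonneg hq.le (by omega)).1 h)
  intro h0
  apply h
  rw [pow_add, pow_mul]
  linarith

lemma coeff_motivicSeries (C : Matrix (Fin m) (Fin m) ℕ) (q : ℝ) (d : Fin m →₀ ℕ) :
    MvPowerSeries.coeff d (motivicSeries C q) =
      (-q) ^ (∑ i, ∑ j, C i j * d i * d j) / ∏ i, qPochhammer (q ^ 2) (q ^ 2) (d i) :=
  rfl

lemma constantCoeff_motivicSeries (C : Matrix (Fin m) (Fin m) ℕ) (q : ℝ) :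
    MvPowerSeries.constantCoeff (motivicSeries C q) = 1 := by
  rw [← MvPowerSeries.coeff_zero_eq_constantCoeff_apply, coeff_motivicSeries]
  simp [qPochhammer]

lemma quadraticForm_add_single (C : Matrix (Fin m) (Fin m) ℕ) (hC : C.IsSymm) (d : Fin m →₀ ℕ)
    (k : Fin m) :
    ∑ i, ∑ j, C i j * (d + Finsupp.single k 1 : Fin m →₀ ℕ) i * (d + Finsupp.single k 1 : Fin m →₀ ℕ) j =
      (∑ i, ∑ j, C i j * d i * d j) + 2 * (∑ i, C k i * d i) + C k k := by
  have h1 : ∀ i, ∑ j, C i j * (d + Finsupp.single k 1 : Fin m →₀ ℕ) i * (d + Finsupp.single k 1 : Fin m →₀ ℕ) j =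
      ∑ j, C i j * d i * d j + (if k = i then ∑ j, C i j * d j else 0) + C i k * d i +
        (if k = i then C i k else 0) := by
    intro i
    simp only [Finsupp.add_apply, Finsupp.single_apply, mul_add, add_mul, Finset.sum_add_distrib]
    split_ifs with h
    · subst h; simp; ring
    · simp
  simp only [h1, Finset.sum_add_distrib, Finset.sum_ite_eq, Finset.mem_univ, if_true]
  have h2 : ∑ i, C i k * d i = ∑ i, C k i * d i :=
    Finset.sum_congr rfl fun i _ => by rw [hC.apply]
  rw [h2]; ring

lemma coeff_motivicSeries_add_single (C : Matrix (Fin m) (Fin m) ℕ) (hC : C.IsSymm) {q : ℝ}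
    (hq : 0 < q) (hq1 : q ≠ 1) (d : Fin m →₀ ℕ) (k : Fin m) :
    (1 - q ^ 2 * (q ^ 2) ^ d k) *
        MvPowerSeries.coeff (d + Finsupp.single k 1) (motivicSeries C q) =
      (-q) ^ C k k * (q ^ 2) ^ (∑ i, C k i * d i) * MvPowerSeries.coeff d (motivicSeries C q) := by
  have hP : ∏ i, qPochhammer (q ^ 2) (q ^ 2) ((d + Finsupp.single k 1 : Fin m →₀ ℕ) i) =
      (∏ i, qPochhammer (q ^ 2) (q ^ 2) (d i)) * (1 - q ^ 2 * (q ^ 2) ^ d k) := by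
    have : ∀ i, qPochhammer (q ^ 2) (q ^ 2) ((d + Finsupp.single k 1 : Fin m →₀ ℕ) i) =
        qPochhammer (q ^ 2) (q ^ 2) (d i) * (if k = i then 1 - q ^ 2 * (q ^ 2) ^ d i else 1) := by
      intro i
      simp only [Finsupp.add_apply, Finsupp.single_apply]
      split_ifs <;> simp [qPochhammer_succ]
    simp only [this, Finset.prod_mul_distrib, Finset.prod_ite_eq, Finset.mem_univ, if_true]
  have h0 := one_sub_pow_ne_zero hq hq1 (d k)
  have hne : ∏ i, qPochhammer (q ^ 2) (q ^ 2) (d i) ≠ 0 :=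
    Finset.prod_ne_zero_iff.2 fun i _ =>
      Finset.prod_ne_zero_iff.2 fun n _ => one_sub_pow_ne_zero hq hq1 n
  rw [coeff_motivicSeries, coeff_motivicSeries, hP, quadraticForm_add_single C hC, pow_add, pow_add,
    pow_mul, neg_sq]
  field_simp

/-- The series `P_C(q ^ (2 c_1) x_1, …, q ^ (2 c_m) x_m)`. -/
noncomputable def shiftedSeries (C : Matrix (Fin m) (Fin m) ℕ) (q : ℝ) (c : Fin m → ℕ) :
    MvPowerSeries (Fin m) ℝ :=
  MvPowerSeries.rescale (fun i => (q ^ 2) ^ c i) (motivicSeries C q)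

/-- The series `P_C(q ^ (2 c_1) x_1, …, q ^ (2 c_m) x_m) / P_C(x_1, …, x_m)`. -/
noncomputable def shiftedQuotient (C : Matrix (Fin m) (Fin m) ℕ) (q : ℝ) (c : Fin m → ℕ) :
    MvPowerSeries (Fin m) ℝ :=
  shiftedSeries C q c * (motivicSeries C q)⁻¹

lemma coeff_rescale_pow (q : ℝ) (c : Fin m → ℕ) (l : Fin m →₀ ℕ) (f : MvPowerSeries (Fin m) ℝ) :
    MvPowerSeries.coeff l (MvPowerSeries.rescale (fun i => (q ^ 2) ^ c i) f) =
      (q ^ 2) ^ (∑ i, c i * l i) * MvPowerSeries.coeff l f := by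
  rw [MvPowerSeries.coeff_rescale, Finsupp.prod_fintype _ _ (by simp), ← Finset.prod_pow_eq_pow_sum]
  simp [pow_mul]

lemma coeff_X_mul_of_eq_zero (f : MvPowerSeries (Fin m) ℝ) (l : Fin m →₀ ℕ) (j : Fin m)
    (hl : l j = 0) : MvPowerSeries.coeff l (MvPowerSeries.X j * f) = 0 := by
  rw [MvPowerSeries.X, MvPowerSeries.coeff_monomial_mul, if_neg]
  intro h
  have := h j
  simp [hl] at this

lemma coeff_add_single_X_mul (f : MvPowerSeries (Fin m) ℝ) (l : Fin m →₀ ℕ) (j : Fin m) :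
    MvPowerSeries.coeff (l + Finsupp.single j 1) (MvPowerSeries.X j * f) =
      MvPowerSeries.coeff l f := by
  rw [MvPowerSeries.X, add_comm, MvPowerSeries.coeff_add_monomial_mul, one_mul]

lemma exists_eq_add_single {l : Fin m →₀ ℕ} {j : Fin m} (hl : l j ≠ 0) :
    ∃ l', l = l' + Finsupp.single j 1 := by
  refine ⟨l - Finsupp.single j 1, ?_⟩
  rw [tsub_add_cancel_of_le]
  rw [Finsupp.single_le_iff]
  omega

/-- At x^l the left side differs from the first term on the right by the factor q^{2l_j}, and 1 -
q^{2l_j} is the factor by which the Pochhammer denominators at l and l - e_j differ. The quadratic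
form contributes the shift by row j. -/
lemma shiftedSeries_add_single (C : Matrix (Fin m) (Fin m) ℕ) (hC : C.IsSymm) {q : ℝ}
    (hq : 0 < q) (hq1 : q ≠ 1) (c : Fin m → ℕ) (j : Fin m) :
    shiftedSeries C q (c + Pi.single j 1) = shiftedSeries C q c -
      MvPowerSeries.C ((-q) ^ C j j * (q ^ 2) ^ c j) *
        (MvPowerSeries.X j * shiftedSeries C q (c + C j)) := by
  ext l
  simp only [map_sub, MvPowerSeries.coeff_C_mul, shiftedSeries]
  by_cases hl : l j = 0
  · rw [coeff_X_mul_of_eq_zero _ _ _ hl, coeff_rescale_pow, coeff_rescale_pow]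
    have : ∑ i, (c + Pi.single j 1 : Fin m → ℕ) i * l i = ∑ i, c i * l i := by
      simp [add_mul, Finset.sum_add_distrib, Pi.single_apply, hl]
    rw [this]; ring
  · obtain ⟨l, rfl⟩ := exists_eq_add_single hl
    rw [coeff_add_single_X_mul, coeff_rescale_pow, coeff_rescale_pow, coeff_rescale_pow]
    have h := coeff_motivicSeries_add_single C hC hq hq1 l j
    have e1 : ∑ i, c i * (l + Finsupp.single j 1 : Fin m →₀ ℕ) i = ∑ i, c i * l i + c j := by
      simp [mul_add, Finset.sum_add_distrib, Finsupp.single_apply]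
    have e2 : ∑ i, (c + Pi.single j 1 : Fin m → ℕ) i * (l + Finsupp.single j 1 : Fin m →₀ ℕ) i =
        ∑ i, c i * l i + c j + (l j + 1) := by
      simp [add_mul, mul_add, Finset.sum_add_distrib, Finsupp.single_apply, Pi.single_apply]
      ring
    have e3 : ∑ i, (c + C j) i * l i = ∑ i, c i * l i + ∑ i, C j i * l i := by
      simp [add_mul, Finset.sum_add_distrib]
    rw [e1, e2, e3]
    simp only [pow_add, pow_one]
    linear_combination -((q ^ 2) ^ (∑ i, c i * l i) * (q ^ 2) ^ c j) * h

lemma shiftedQuotient_add_single (C : Matrix (Fin m) (Fin m) ℕ) (hC : C.IsSymm) {q : ℝ}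
    (hq : 0 < q) (hq1 : q ≠ 1) (c : Fin m → ℕ) (j : Fin m) :
    shiftedQuotient C q (c + Pi.single j 1) = shiftedQuotient C q c -
      MvPowerSeries.C ((-q) ^ C j j * (q ^ 2) ^ c j) *
        (MvPowerSeries.X j * shiftedQuotient C q (c + C j)) := by
  simp only [shiftedQuotient, shiftedSeries_add_single C hC hq hq1 c j]
  ring

lemma shiftedQuotient_zero (C : Matrix (Fin m) (Fin m) ℕ) (q : ℝ) :
    shiftedQuotient C q 0 = 1 := by
  have : shiftedSeries C q 0 = motivicSeries C q := by
    ext l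
    rw [shiftedSeries, coeff_rescale_pow]
    simp
  rw [shiftedQuotient, this, MvPowerSeries.mul_inv_cancel]
  rw [constantCoeff_motivicSeries]; exact one_ne_zero

/-- The cocycle identity P(q^{2(a+b)}x)/P(x) = P(q^{2(a+b)}x)/P(q^{2a}x) · P(q^{2a}x)/P(x). -/
lemma shiftedQuotient_add (C : Matrix (Fin m) (Fin m) ℕ) (q : ℝ) (a b : Fin m → ℕ) :
    shiftedQuotient C q (a + b) =
      MvPowerSeries.rescale (fun i => (q ^ 2) ^ a i) (shiftedQuotient C q b) *
        shiftedQuotient C q a := by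
  have h1 : MvPowerSeries.constantCoeff (motivicSeries C q) ≠ 0 := by
    rw [constantCoeff_motivicSeries]; exact one_ne_zero
  have h2 : shiftedSeries C q (a + b) = MvPowerSeries.rescale (fun i => (q ^ 2) ^ a i)
      (shiftedSeries C q b) := by
    rw [shiftedSeries, shiftedSeries, MvPowerSeries.rescale_rescale]
    congr 2
    ext i
    simp [pow_add, mul_comm]
  have h3 : MvPowerSeries.rescale (fun i => (q ^ 2) ^ a i) (motivicSeries C q)⁻¹ *
      shiftedSeries C q a = 1 := by
    rw [shiftedSeries, ← map_mul, MvPowerSeries.inv_mul_cancel _ h1, map_one]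
  rw [shiftedQuotient, shiftedQuotient, shiftedQuotient, map_mul, h2]
  linear_combination -(MvPowerSeries.rescale (fun i => (q ^ 2) ^ a i) (shiftedSeries C q b)) *
    (motivicSeries C q)⁻¹ * h3

lemma signExponent_add_single (C : Matrix (Fin m) (Fin m) ℕ) (l : Fin m →₀ ℕ) (j : Fin m) :
    signExponent C (l + Finsupp.single j 1) = signExponent C l + (C j j + 1) := by
  simp [signExponent, mul_add, Finset.sum_add_distrib, Finsupp.single_apply]

/-- The limit of `P_C(q ^ (2 c_1) x_1, …, q ^ (2 c_m) x_m) / P_C(x_1, …, x_m)` as `q → 1`. -/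
noncomputable def limitSeries (C : Matrix (Fin m) (Fin m) ℕ) (c : Fin m → ℕ) :
    MvPowerSeries (Fin m) ℝ :=
  fun l => (-1) ^ signExponent C l * lagrangeCoeff C c l

lemma coeff_limitSeries (C : Matrix (Fin m) (Fin m) ℕ) (c : Fin m → ℕ) (l : Fin m →₀ ℕ) :
    MvPowerSeries.coeff l (limitSeries C c) = (-1) ^ signExponent C l * lagrangeCoeff C c l :=
  rfl

lemma eventually_pos_ne_one : ∀ᶠ q : ℝ in 𝓝[≠] 1, 0 < q ∧ q ≠ 1 := by
  refine (Filter.Eventually.filter_mono nhdsWithin_le_nhds (lt_mem_nhds one_pos)).and ?_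
  exact eventually_mem_nhdsWithin

lemma pi_induction_single {p : (Fin m → ℕ) → Prop} (h0 : p 0)
    (h : ∀ c j, p c → p (c + Pi.single j 1)) (c : Fin m → ℕ) : p c := by
  induction hn : ∑ i, c i generalizing c with
  | zero =>
    have : c = 0 := by
      ext i
      exact (Finset.sum_eq_zero_iff.1 hn) i (Finset.mem_univ i)
    rwa [this]
  | succ n ih =>
    obtain ⟨j, hj⟩ : ∃ j, c j ≠ 0 := by
      by_contra! h'
      simp [h'] at hn
    have e : c = (c - Pi.single j 1) + Pi.single j 1 := by
      ext i
      by_cases hi : i = j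
      · subst hi; simp; omega
      · simp [Pi.single_eq_of_ne hi]
    rw [e]
    apply h
    apply ih
    rw [e] at hn
    simp only [Pi.add_apply, Finset.sum_add_distrib, Finset.sum_pi_single', Finset.mem_univ,
      if_true] at hn
    omega

/-- Outer induction on the degree of l for all c at once, inner induction on c. The last term of the
q-difference equation carries x_j, so it needs only lower degree, but at the unrelated shift c +
C_j. -/
lemma tendsto_coeff_shiftedQuotient (C : Matrix (Fin m) (Fin m) ℕ) (hC : C.IsSymm)
    (l : Fin m →₀ ℕ) (c : Fin m → ℕ) :
    Tendsto (fun q : ℝ => MvPowerSeries.coeff l (shiftedQuotient C q c)) (𝓝[≠] 1)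
      (𝓝 (MvPowerSeries.coeff l (limitSeries C c))) := by
  induction hn : l.degree generalizing l c with
  | zero =>
    obtain rfl : l = 0 := (Finsupp.degree_eq_zero_iff l).1 hn
    induction c using pi_induction_single with
    | h0 =>
      simp [shiftedQuotient_zero, coeff_limitSeries, lagrangeCoeff_zero_right, signExponent]
    | h c j ih =>
      rw [coeff_limitSeries, lagrangeCoeff_add_single_of_eq_zero _ _ _ _ (by simp),
        ← coeff_limitSeries]
      refine ih.congr' ?_
      filter_upwards [eventually_pos_ne_one] with q hq
      rw [shiftedQuotient_add_single C hC hq.1 hq.2, map_sub, MvPowerSeries.coeff_C_mul,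
        coeff_X_mul_of_eq_zero _ _ _ (by simp)]
      simp
  | succ n IH =>
    induction c using pi_induction_single with
    | h0 =>
      have hl : l ≠ 0 := by rintro rfl; simp at hn
      simp [shiftedQuotient_zero, coeff_limitSeries, lagrangeCoeff_zero_left C hC l hl,
        MvPowerSeries.coeff_one, hl]
    | h c j ih =>
      by_cases hl : l j = 0
      · rw [coeff_limitSeries, lagrangeCoeff_add_single_of_eq_zero _ _ _ _ hl, ← coeff_limitSeries]
        refine ih.congr' ?_
        filter_upwards [eventually_pos_ne_one] with q hq
        rw [shiftedQuotient_add_single C hC hq.1 hq.2, map_sub, MvPowerSeries.coeff_C_mul,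
          coeff_X_mul_of_eq_zero _ _ _ hl]
        simp
      · obtain ⟨l', rfl⟩ := exists_eq_add_single hl
        have hn' : l'.degree = n := by
          simpa using hn
        have hcont : Tendsto (fun q : ℝ => (-q) ^ C j j * (q ^ 2) ^ c j) (𝓝[≠] 1)
            (𝓝 ((-1) ^ C j j * (1 ^ 2) ^ c j)) := by
          apply Tendsto.mono_left _ nhdsWithin_le_nhds
          exact Continuous.tendsto (by fun_prop) 1
        have key := ih.sub (hcont.mul (IH l' (c + C j) hn'))
        have e : MvPowerSeries.coeff (l' + Finsupp.single j 1) (limitSeries C (c + Pi.single j 1)) =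
            MvPowerSeries.coeff (l' + Finsupp.single j 1) (limitSeries C c) -
              (-1) ^ C j j * (1 ^ 2) ^ c j * MvPowerSeries.coeff l' (limitSeries C (c + C j)) := by
          simp only [coeff_limitSeries, lagrangeCoeff_add_single, signExponent_add_single, pow_add]
          ring
        rw [e]
        refine key.congr' ?_
        filter_upwards [eventually_pos_ne_one] with q hq
        rw [shiftedQuotient_add_single C hC hq.1 hq.2, map_sub, MvPowerSeries.coeff_C_mul,
          coeff_add_single_X_mul]

lemma limitSeries_zero (C : Matrix (Fin m) (Fin m) ℕ) (hC : C.IsSymm) :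
    limitSeries C 0 = 1 := by
  ext l
  have h := tendsto_coeff_shiftedQuotient C hC l 0
  simp only [shiftedQuotient_zero] at h
  exact tendsto_nhds_unique h tendsto_const_nhds

/-- In the cocycle identity the rescaling by q^{2a} disappears as q → 1, leaving a plain product. -/
lemma limitSeries_add (C : Matrix (Fin m) (Fin m) ℕ) (hC : C.IsSymm) (a b : Fin m → ℕ) :
    limitSeries C (a + b) = limitSeries C b * limitSeries C a := by
  ext l
  refine tendsto_nhds_unique (tendsto_coeff_shiftedQuotient C hC l (a + b)) ?_
  simp only [shiftedQuotient_add, MvPowerSeries.coeff_mul, coeff_rescale_pow]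
  refine tendsto_finsetSum _ fun p _ => ?_
  have hcont : Tendsto (fun q : ℝ => (q ^ 2) ^ ∑ i, a i * p.1 i) (𝓝[≠] 1) (𝓝 1) := by
    apply Tendsto.mono_left _ nhdsWithin_le_nhds
    have : Continuous (fun q : ℝ => (q ^ 2) ^ ∑ i, a i * p.1 i) := by fun_prop
    simpa using this.tendsto 1
  simpa using (hcont.mul (tendsto_coeff_shiftedQuotient C hC p.1 b)).mul
    (tendsto_coeff_shiftedQuotient C hC p.2 a)

lemma limitSeries_const_pow (C : Matrix (Fin m) (Fin m) ℕ) (hC : C.IsSymm) (n : ℕ) :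
    limitSeries C (fun _ => n) = limitSeries C (fun _ => 1) ^ n := by
  induction n with
  | zero => exact limitSeries_zero C hC
  | succ n ih =>
    rw [pow_succ, ← ih, mul_comm]
    exact limitSeries_add C hC (fun _ => n) (fun _ => 1)

lemma isClassicalLimit_limitSeries (C : Matrix (Fin m) (Fin m) ℕ) (hC : C.IsSymm) :
    IsClassicalLimit C (limitSeries C (fun _ => 1)) := by
  intro l
  have h := tendsto_coeff_shiftedQuotient C hC l (fun _ => 1)
  simp only [shiftedQuotient, shiftedSeries, pow_one] at h
  exact h

lemma constantCoeff_limitSeries (C : Matrix (Fin m) (Fin m) ℕ) (c : Fin m → ℕ) :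
    MvPowerSeries.constantCoeff (limitSeries C c) = 1 := by
  rw [← MvPowerSeries.coeff_zero_eq_constantCoeff_apply, coeff_limitSeries,
    lagrangeCoeff_zero_right]
  simp [signExponent]

/-- The same determinant can be formed over ℤ, since ℤ is itself a binomial ring. -/
lemma exists_int_coeff_limitSeries (C : Matrix (Fin m) (Fin m) ℕ) (c : Fin m → ℕ)
    (l : Fin m →₀ ℕ) : ∃ z : ℤ, MvPowerSeries.coeff l (limitSeries C c) = z := by
  refine ⟨(-1) ^ signExponent C l * (lagrangeMatrix (C.map (fun n : ℕ => (n : ℤ)))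
    (fun i => (c i : ℤ) + ∑ k, (C k i : ℤ) * (l k : ℤ)) l).det, ?_⟩
  have h := map_det_lagrangeMatrix (Int.castRingHom ℝ) (C.map (fun n : ℕ => (n : ℤ)))
    (fun i => (c i : ℤ) + ∑ k, (C k i : ℤ) * (l k : ℤ)) l
  rw [eq_intCast] at h
  rw [coeff_limitSeries]
  rw [Int.cast_mul, h, lagrangeCoeff]
  push_cast
  congr 3
  ext i
  simp [linForm]

end ClassicalLimit

/-! ### Rooted forests and the matrix-tree theorem -/

section MatrixTree

variable {m : ℕ}

/-- The edges from the parents to their children, for a partial parent function `p`. -/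
def parentGraph (p : Fin m → Option (Fin m)) : Finset (Fin m × Fin m) :=
  univ.filter fun e => p e.2 = some e.1

lemma mem_parentGraph {p : Fin m → Option (Fin m)} {e : Fin m × Fin m} :
    e ∈ parentGraph p ↔ p e.2 = some e.1 := by
  simp [parentGraph]

lemma parentGraph_injective : Function.Injective (parentGraph (m := m)) := by
  intro p p' h
  ext j i
  have := Finset.ext_iff.1 h (i, j)
  simpa [mem_parentGraph] using this

lemma exists_parentGraph_eq {S : Finset (Fin m × Fin m)}
    (hS : ∀ e ∈ S, ∀ e' ∈ S, e.2 = e'.2 → e = e') : ∃ p, parentGraph p = S := by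
  classical
  refine ⟨fun j => if h : ∃ i, (i, j) ∈ S then some h.choose else none, ?_⟩
  ext ⟨i, j⟩
  rw [mem_parentGraph]
  dsimp only
  constructor
  · intro h
    split_ifs at h with h'
    have := h'.choose_spec
    rw [Option.some.inj h] at this
    exact this
  · intro h
    have h' : ∃ i, (i, j) ∈ S := ⟨i, h⟩
    rw [dif_pos h']
    have := hS _ h'.choose_spec _ h rfl
    rw [(Prod.mk.inj this).1]

lemma iterate_bind_none (p : Fin m → Option (Fin m)) (k : ℕ) :
    (fun o : Option (Fin m) => o.bind p)^[k] none = none :=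
  Function.iterate_fixed rfl k

/-- If the chain of ancestors never stopped, finiteness would make it eventually periodic, and one
minimal period of it would be a forbidden cycle of distinct pairs. -/
lemma exists_iterate_parent_eq_none {p : Fin m → Option (Fin m)}
    (hp : IsAdmissible (parentGraph p)) (j : Fin m) :
    ∃ k, (fun o : Option (Fin m) => o.bind p)^[k] (some j) = none := by
  set F := fun o : Option (Fin m) => o.bind p with hF
  by_contra! hne
  obtain ⟨a, b, hab, h⟩ := Finite.exists_ne_map_eq_of_infinite fun k => F^[k] (some j)
  wlog hlt : a < b generalizing a b
  · exact this b a hab.symm h.symm (by omega)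
  set z := F^[a] (some j) with hz
  have hper : z ∈ Function.periodicPts F := by
    refine ⟨b - a, by omega, ?_⟩
    change F^[b - a] (F^[a] (some j)) = z
    rw [← Function.iterate_add_apply, Nat.sub_add_cancel hlt.le]
    exact h.symm
  have hsome : ∀ k, ∃ v, F^[k] z = some v := by
    intro k
    rw [← Option.ne_none_iff_exists', hz, ← Function.iterate_add_apply]
    exact hne _
  choose v hv using hsome
  have hstep : ∀ k, p (v k) = some (v (k + 1)) := by
    intro k
    rw [← hv (k + 1), Function.iterate_succ_apply', hv k]
    rfl
  obtain ⟨n, hn⟩ : ∃ n, Function.minimalPeriod F z = n + 1 :=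
    Nat.exists_eq_succ_of_ne_zero (Function.minimalPeriod_pos_of_mem_periodicPts hper).ne'
  have hwrap : v (n + 1) = v 0 := by
    apply Option.some.inj
    rw [← hv, ← hv, ← hn, Function.iterate_minimalPeriod]
    rfl
  -- Pairs are (parent, child), whereas v climbs from child to parent; the cycle is therefore
  -- traversed backwards. It closes up because v (n + 1) = v 0.
  refine hp.2 n (fun t => (v (n - t + 1), v (n - t))) ?_ ?_ ?_
  · intro t t' htt
    have h2 : F^[n - t] z = F^[n - t'] z := by
      rw [hv, hv, (Prod.mk.inj htt).2]
    have := Function.iterate_injOn_Iio_minimalPeriod (f := F) (x := z)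
      (by simp only [hn, Set.mem_Iio]; omega) (by simp only [hn, Set.mem_Iio]; omega) h2
    ext
    have := t.2
    have := t'.2
    omega
  · intro t
    rw [mem_parentGraph]
    exact hstep _
  · intro t
    dsimp only
    by_cases ht : t = Fin.last n
    · subst ht
      simp [hwrap]
    · have h1 : ((t + 1 : Fin (n + 1)) : ℕ) = t + 1 := Fin.val_add_one_of_lt (Fin.lt_last_iff_ne_last.2 ht)
      have h2 : (t : ℕ) < n := Fin.lt_last_iff_ne_last.2 ht
      rw [h1]
      congr 1
      omega

section Det

variable {R : Type*} [CommRing R]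

/-- The matrix of a partial parent function. -/
def parentMatrix (R : Type*) [CommRing R] (p : Fin m → Option (Fin m)) :
    Matrix (Fin m) (Fin m) R :=
  fun j i => if p j = some i then 1 else 0

lemma parentMatrix_pow (p : Fin m → Option (Fin m)) (k : ℕ) (j i : Fin m) :
    (parentMatrix R p ^ k) j i =
      if (fun o : Option (Fin m) => o.bind p)^[k] (some j) = some i then 1 else 0 := by
  induction k generalizing j with
  | zero => simp [Matrix.one_apply]
  | succ k ih =>
    rw [pow_succ', Matrix.mul_apply]
    simp only [ih, Function.iterate_succ_apply, Option.bind_some, parentMatrix]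
    rcases (p j).eq_none_or_eq_some with h | ⟨a, h⟩
    · simp [h, iterate_bind_none]
    · simp only [h, Option.some.injEq, ite_mul, one_mul, zero_mul, Finset.sum_ite_eq,
        Finset.mem_univ, if_true]

/-- Powers of the parent matrix record iterated ancestors, so without cycles it is nilpotent. Its
characteristic polynomial is then X^m, with value 1 at 1. -/
lemma det_one_sub_parentMatrix_of_isAdmissible [IsDomain R] {p : Fin m → Option (Fin m)}
    (hp : IsAdmissible (parentGraph p)) : (1 - parentMatrix R p).det = 1 := by
  choose k hk using exists_iterate_parent_eq_none hp
  have hnil : IsNilpotent (parentMatrix R p) := by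
    refine ⟨∑ j, k j, ?_⟩
    ext j i
    have h1 : k j ≤ ∑ j, k j := Finset.single_le_sum (fun _ _ => Nat.zero_le _) (Finset.mem_univ j)
    rw [parentMatrix_pow, ← Nat.sub_add_cancel h1, Function.iterate_add_apply, hk,
      iterate_bind_none]
    simp
  have h := (Matrix.isNilpotent_charpoly_sub_pow_of_isNilpotent hnil).eq_zero
  have h2 := Matrix.eval_charpoly (parentMatrix R p) 1
  rw [sub_eq_zero.1 h] at h2
  simpa using h2.symm

/-- Row j is e_j - e_{p(j)}. Adding up these rows over the children on a cycle telescopes to 0, so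
the vector counting visits is a left kernel vector; characteristic zero keeps it nonzero. -/
lemma det_one_sub_parentMatrix_of_not_isAdmissible [IsDomain R] [CharZero R]
    {p : Fin m → Option (Fin m)}
    (hp : ¬ IsAdmissible (parentGraph p)) : (1 - parentMatrix R p).det = 0 := by
  have h1 : ∀ e ∈ parentGraph p, ∀ e' ∈ parentGraph p, e.2 = e'.2 → e = e' := by
    rintro ⟨i, j⟩ he ⟨i', j'⟩ he' h
    simp only [mem_parentGraph] at he he' h
    subst h
    rw [he] at he'
    rw [Option.some.inj he']
  rw [IsAdmissible, not_and] at hp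
  have h2 := hp h1
  push Not at h2
  obtain ⟨n, f, -, hf, hc⟩ := h2
  rw [← Matrix.exists_vecMul_eq_zero_iff]
  refine ⟨fun j => ((univ.filter fun t => (f t).2 = j).card : R), ?_, ?_⟩
  · intro h0
    have := congrFun h0 (f 0).2
    simp only [Pi.zero_apply, Nat.cast_eq_zero, Finset.card_eq_zero] at this
    have h0 : (0 : Fin (n + 1)) ∈ univ.filter fun t => (f t).2 = (f 0).2 := by simp
    rw [this] at h0
    simp at h0
  · ext i
    have hsum : ∀ g : Fin m → R,
        ∑ j, ((univ.filter fun t => (f t).2 = j).card : R) * g j = ∑ t, g (f t).2 := by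
      intro g
      simp only [Finset.card_filter, Nat.cast_sum, Finset.sum_mul]
      rw [Finset.sum_comm]
      simp
    simp only [Matrix.vecMul, dotProduct, Pi.zero_apply]
    rw [hsum fun j => (1 - parentMatrix R p) j i]
    have h3 : ∀ t, (1 - parentMatrix R p) (f t).2 i =
        (if (f (t + 1)).1 = i then 1 else 0) - (if (f t).1 = i then 1 else 0) := by
      intro t
      have := mem_parentGraph.1 (hf t)
      simp only [parentMatrix, this, Matrix.sub_apply, Matrix.one_apply, ← hc t, Option.some.injEq]
    simp only [h3, Finset.sum_sub_distrib]
    rw [sub_eq_zero]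
    exact Equiv.sum_comp (Equiv.addRight (1 : Fin (n + 1)))
      fun t => if (f t).1 = i then (1 : R) else 0

lemma prod_parent_elim (p : Fin m → Option (Fin m)) (x : R) (w : Matrix (Fin m) (Fin m) R) :
    ∏ j, (p j).elim x (fun i => w i j) =
      x ^ (m - (parentGraph p).card) * ∏ e ∈ parentGraph p, w e.1 e.2 := by
  have h1 : ∏ e ∈ parentGraph p, w e.1 e.2 = ∏ j, (p j).elim 1 (fun i => w i j) := by
    rw [parentGraph, Finset.prod_filter, Fintype.prod_prod_type_right]
    refine Finset.prod_congr rfl fun j _ => ?_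
    rcases (p j).eq_none_or_eq_some with h | ⟨a, h⟩ <;> simp [h]
  have h2 : (parentGraph p).card = ∑ j, (p j).elim 0 (fun _ => 1) := by
    rw [parentGraph, Finset.card_filter, Fintype.sum_prod_type_right]
    refine Finset.sum_congr rfl fun j _ => ?_
    rcases (p j).eq_none_or_eq_some with h | ⟨a, h⟩ <;> simp [h]
  have h3 : m - (parentGraph p).card = ∑ j, (p j).elim 1 (fun _ => 0) := by
    have : ∑ j, (p j).elim 1 (fun _ => 0) + ∑ j, (p j).elim 0 (fun _ => 1) = m := by
      rw [← Finset.sum_add_distrib]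
      have : ∀ j, (p j).elim 1 (fun _ => 0) + (p j).elim 0 (fun _ => 1) = 1 := fun j => by
        cases p j <;> simp
      simp [this]
    omega
  rw [h1, h3, ← Finset.prod_pow_eq_pow_sum, ← Finset.prod_mul_distrib]
  refine Finset.prod_congr rfl fun j _ => ?_
  cases p j <;> simp

open Classical in
/-- The matrix-tree theorem for rooted forests. -/
theorem det_add_laplacian [IsDomain R] [CharZero R] (x : R) (w : Matrix (Fin m) (Fin m) R) :
    (Matrix.diagonal (fun j => x + ∑ k, w k j) - w).det =
      ∑ S : Finset (Fin m × Fin m) with IsAdmissible S,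
        x ^ (m - S.card) * ∏ e ∈ S, w e.1 e.2 := by
  -- Column j is x e_j + ∑_i w_ij (e_j - e_i): either j is a root, or it chooses a parent i.
  -- Multilinear expansion then runs over all partial parent functions, and the remaining
  -- determinants are 1 for forests and 0 otherwise.
  have hrow : (Matrix.diagonal (fun j => x + ∑ k, w k j) - w).transpose =
      fun j => ∑ o : Option (Fin m), (o.elim x (fun i => w i j)) •
        (fun i => (if j = i then (1 : R) else 0) - if o = some i then 1 else 0) := by
    ext j i
    simp only [Matrix.transpose_apply, Matrix.sub_apply, Matrix.diagonal_apply, Finset.sum_apply,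
      Pi.smul_apply, smul_eq_mul, Fintype.sum_option, Option.elim_none, Option.elim_some, mul_sub,
      Finset.sum_sub_distrib, reduceCtorEq, if_false, Option.some.injEq]
    by_cases h : j = i
    · subst h; simp
    · simp [h, Ne.symm h]
  rw [← Matrix.det_transpose, hrow]
  change Matrix.detRowAlternating.toMultilinearMap _ = _
  rw [MultilinearMap.map_sum]
  simp only [MultilinearMap.map_smul_univ, smul_eq_mul]
  have hterm : ∀ p : Fin m → Option (Fin m),
      (∏ j, (p j).elim x (fun i => w i j)) * Matrix.detRowAlternating.toMultilinearMap
        (fun j i => (if j = i then (1 : R) else 0) - if p j = some i then 1 else 0) =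
      if IsAdmissible (parentGraph p) then
        x ^ (m - (parentGraph p).card) * ∏ e ∈ parentGraph p, w e.1 e.2 else 0 := by
    intro p
    have e : (fun j i => (if j = i then (1 : R) else 0) - if p j = some i then 1 else 0) =
        (1 - parentMatrix R p : Matrix (Fin m) (Fin m) R) := by
      ext j i
      simp [parentMatrix, Matrix.one_apply]
    rw [e]
    change _ * Matrix.det _ = _
    rw [prod_parent_elim]
    split_ifs with h
    · rw [det_one_sub_parentMatrix_of_isAdmissible h, mul_one]
    · rw [det_one_sub_parentMatrix_of_not_isAdmissible h, mul_zero]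
  rw [Finset.sum_congr rfl fun p _ => hterm p, ← Finset.sum_filter]
  refine Finset.sum_nbij parentGraph ?_ parentGraph_injective.injOn ?_ fun _ _ => rfl
  · intro p hp
    simpa using hp
  · intro S hS
    have hS : IsAdmissible S := by simpa using hS
    obtain ⟨p, rfl⟩ := exists_parentGraph_eq hS.1
    exact ⟨p, by simpa using hS, rfl⟩

end Det

/-- With m pairs every vertex would have a parent, and no chain of ancestors could stop. -/
lemma IsAdmissible.card_le {S : Finset (Fin m × Fin m)} (hS : IsAdmissible S) :
    S.card ≤ m - 1 := by
  obtain ⟨p, rfl⟩ := exists_parentGraph_eq hS.1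
  have hle : (parentGraph p).card ≤ m := by
    have := Finset.card_le_card_of_injOn Prod.snd (s := parentGraph p) (t := univ) (by simp)
      (fun e he e' he' h => hS.1 e he e' he' h)
    simpa using this
  by_contra hlt
  have hcard : (parentGraph p).card = m := by omega
  have hm : 0 < m := by
    rcases Nat.eq_zero_or_pos m with rfl | h
    · simp [hcard] at hlt
    · exact h
  have hall : ∀ j, p j ≠ none := by
    intro j hj
    have h1 : ((parentGraph p).image Prod.snd) = univ := by
      rw [← Finset.card_eq_iff_eq_univ, Finset.card_image_of_injOn
        (fun e he e' he' h => hS.1 e he e' he' h), hcard, Fintype.card_fin]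
    have h2 := Finset.mem_univ j
    rw [← h1, Finset.mem_image] at h2
    obtain ⟨e, he, rfl⟩ := h2
    rw [mem_parentGraph, hj] at he
    exact absurd he (by simp)
  obtain ⟨k, hk⟩ := exists_iterate_parent_eq_none hS ⟨0, hm⟩
  have : ∀ k, (fun o : Option (Fin m) => o.bind p)^[k] (some ⟨0, hm⟩) ≠ none := by
    intro k
    induction k with
    | zero => simp
    | succ k ih =>
      rw [Function.iterate_succ_apply']
      obtain ⟨v, hv⟩ := Option.ne_none_iff_exists'.1 ih
      rw [hv]
      exact hall v
  exact this k hk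

lemma exists_isAdmissible_card (m : ℕ) :
    ∃ S : Finset (Fin m × Fin m), IsAdmissible S ∧ S.card = m - 1 := by
  cases m with
  | zero => exact ⟨∅, ⟨by simp, fun n f _ hf => absurd (hf 0) (by simp)⟩, rfl⟩
  | succ m =>
    -- The star with centre 0: no second entry is ever a first entry, so there is no cycle.
    refine ⟨univ.image fun j : Fin m => (0, j.succ), ⟨?_, ?_⟩, ?_⟩
    · intro e he e' he' h
      simp only [Finset.mem_image, Finset.mem_univ, true_and] at he he'
      obtain ⟨j, rfl⟩ := he
      obtain ⟨j', rfl⟩ := he'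
      simpa using h
    · intro n f _ hf hc
      have h0 := hf 0
      have h1 := hf (0 + 1)
      have h2 := hc 0
      simp only [Finset.mem_image, Finset.mem_univ, true_and] at h0 h1
      obtain ⟨j, hj⟩ := h0
      obtain ⟨j', hj'⟩ := h1
      rw [← hj, ← hj'] at h2
      exact Fin.succ_ne_zero j h2
    · rw [Finset.card_image_of_injective _ (fun a b h => by simpa using h)]
      simp

end MatrixTree

/-! ### The formal logarithm as the linear term of f^a in a -/

section Logarithm

variable {m : ℕ}

/-- The ideal of the power series without terms of degree at most `n`. -/
def highDegreeIdeal (m n : ℕ) : Ideal (MvPowerSeries (Fin m) ℝ) where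
  carrier := {f | ∀ l : Fin m →₀ ℕ, l.degree ≤ n → MvPowerSeries.coeff l f = 0}
  add_mem' := by
    intro f g hf hg l hl
    rw [map_add, hf l hl, hg l hl, add_zero]
  zero_mem' := by simp
  smul_mem' := by
    intro f g hg l hl
    rw [smul_eq_mul, MvPowerSeries.coeff_mul]
    refine Finset.sum_eq_zero fun p hp => ?_
    rw [hg p.2 ?_, mul_zero]
    rw [← Finset.HasAntidiagonal.mem_antidiagonal.1 hp, map_add] at hl
    omega

lemma mem_highDegreeIdeal {n : ℕ} {f : MvPowerSeries (Fin m) ℝ} :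
    f ∈ highDegreeIdeal m n ↔
      ∀ l : Fin m →₀ ℕ, l.degree ≤ n → MvPowerSeries.coeff l f = 0 :=
  Iff.rfl

/-- Truncation of power series, as a ring homomorphism. -/
noncomputable abbrev truncHom (m n : ℕ) :
    MvPowerSeries (Fin m) ℝ →+* MvPowerSeries (Fin m) ℝ ⧸ highDegreeIdeal m n :=
  Ideal.Quotient.mk (highDegreeIdeal m n)

lemma truncHom_eq_iff {n : ℕ} {f g : MvPowerSeries (Fin m) ℝ} :
    truncHom m n f = truncHom m n g ↔
      ∀ l : Fin m →₀ ℕ, l.degree ≤ n → MvPowerSeries.coeff l f = MvPowerSeries.coeff l g := by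
  rw [Ideal.Quotient.mk_eq_mk_iff_sub_mem, mem_highDegreeIdeal]
  simp only [map_sub, sub_eq_zero]

lemma coeff_pow_eq_zero_of_degree_lt {g : MvPowerSeries (Fin m) ℝ}
    (hg : MvPowerSeries.constantCoeff g = 0) {l : Fin m →₀ ℕ} {k : ℕ} (h : l.degree < k) :
    MvPowerSeries.coeff l (g ^ k) = 0 :=
  MvPowerSeries.coeff_eq_zero_of_constantCoeff_nilpotent (m := 1) (by simpa using hg) (by omega)

lemma coeff_logSeries {f : MvPowerSeries (Fin m) ℝ} (hf : MvPowerSeries.constantCoeff f = 1)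
    (l : Fin m →₀ ℕ) :
    MvPowerSeries.coeff l (logSeries f) = ∑ k ∈ range (l.degree + 1),
      PowerSeries.coeff k (PowerSeries.log ℝ) * MvPowerSeries.coeff l ((f - 1) ^ k) := by
  have h0 : MvPowerSeries.constantCoeff (f - 1) = 0 := by rw [map_sub, hf, map_one, sub_self]
  rw [logSeries, PowerSeries.coeff_subst (PowerSeries.HasSubst.of_constantCoeff_zero h0)]
  rw [finsum_eq_sum_of_support_subset]
  · rfl
  · intro k hk
    by_contra hlt
    simp only [coe_range, Set.mem_Iio, not_lt] at hlt
    apply hk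
    simp only
    rw [coeff_pow_eq_zero_of_degree_lt h0 (by omega), smul_zero]

/-- The polynomial in `a` whose value is the coefficient of `x ^ l` in `f ^ a`. -/
noncomputable def powPolynomial (f : MvPowerSeries (Fin m) ℝ) (l : Fin m →₀ ℕ) :
    Polynomial ℝ :=
  ∑ k ∈ range (l.degree + 1),
    Polynomial.C (MvPowerSeries.coeff l ((f - 1) ^ k)) * Ring.choose Polynomial.X k

/-- This is the binomial theorem for (1 + (f - 1))^a. The sum may be cut at deg l because (f - 1)^k
starts in degree k, or at a because binom(a, k) vanishes beyond it. -/
lemma eval_powPolynomial {f : MvPowerSeries (Fin m) ℝ}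
    (hf : MvPowerSeries.constantCoeff f = 1) (l : Fin m →₀ ℕ) (a : ℕ) :
    (powPolynomial f l).eval (a : ℝ) = MvPowerSeries.coeff l (f ^ a) := by
  have h0 : MvPowerSeries.constantCoeff (f - 1) = 0 := by rw [map_sub, hf, map_one, sub_self]
  have hch : ∀ k, (Ring.choose (Polynomial.X : Polynomial ℝ) k).eval (a : ℝ) = (a.choose k : ℝ) := by
    intro k
    have := Ring.map_choose (Polynomial.evalRingHom (a : ℝ)) Polynomial.X k
    simpa [Ring.choose_natCast] using this
  have h1 : MvPowerSeries.coeff l (f ^ a) =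
      ∑ k ∈ range (a + 1), MvPowerSeries.coeff l ((f - 1) ^ k) * (a.choose k : ℝ) := by
    conv_lhs => rw [← sub_add_cancel f 1, add_pow, map_sum]
    refine Finset.sum_congr rfl fun k _ => ?_
    rw [one_pow, mul_one, ← map_natCast (MvPowerSeries.C (σ := Fin m) (R := ℝ)), mul_comm,
      MvPowerSeries.coeff_C_mul, mul_comm]
  rw [h1, powPolynomial, Polynomial.eval_finsetSum]
  simp only [Polynomial.eval_mul, Polynomial.eval_C, hch]
  have e1 : ∑ k ∈ range (l.degree + 1), MvPowerSeries.coeff l ((f - 1) ^ k) * (a.choose k : ℝ) =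
      ∑ k ∈ range (l.degree + a + 1),
        MvPowerSeries.coeff l ((f - 1) ^ k) * (a.choose k : ℝ) := by
    refine Finset.sum_subset (by intro k; simp only [mem_range]; omega) fun k _ hk => ?_
    rw [coeff_pow_eq_zero_of_degree_lt h0 (by simpa using hk), zero_mul]
  have e2 : ∑ k ∈ range (a + 1), MvPowerSeries.coeff l ((f - 1) ^ k) * (a.choose k : ℝ) =
      ∑ k ∈ range (l.degree + a + 1),
        MvPowerSeries.coeff l ((f - 1) ^ k) * (a.choose k : ℝ) := by
    refine Finset.sum_subset (by intro k; simp only [mem_range]; omega) fun k _ hk => ?_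
    rw [Nat.choose_eq_zero_of_lt (by simpa using hk), Nat.cast_zero, mul_zero]
  rw [e1, e2]

lemma polynomial_eq_of_eval_natCast {p p' : Polynomial ℝ}
    (h : ∀ a : ℕ, p.eval (a : ℝ) = p'.eval (a : ℝ)) : p = p' := by
  apply Polynomial.eq_of_infinite_eval_eq
  refine (Set.infinite_range_of_injective (Nat.cast_injective (R := ℝ))).mono ?_
  rintro _ ⟨a, rfl⟩
  exact h a

/-- By absorption, k binom(X, k) = X binom(X - 1, k - 1), so the linear coefficient is binom(-1, k -
1)/k = (-1)^(k-1)/k, as in the Mercator series. -/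
lemma coeff_one_choose_X (k : ℕ) :
    (Ring.choose (Polynomial.X : Polynomial ℝ) k).coeff 1 =
      PowerSeries.coeff k (PowerSeries.log ℝ) := by
  cases k with
  | zero => simp [Polynomial.coeff_one]
  | succ n =>
    have h := congrArg (fun p => Polynomial.coeff p 1)
      (natCast_mul_choose (Polynomial.X : Polynomial ℝ) (n + 1))
    have h2 : (Ring.choose (Polynomial.X - 1 : Polynomial ℝ) n).coeff 0 = (-1) ^ n := by
      rw [Polynomial.coeff_zero_eq_eval_zero]
      have := Ring.map_choose (Polynomial.evalRingHom (0 : ℝ)) (Polynomial.X - 1) n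
      simp only [Polynomial.coe_evalRingHom, Polynomial.eval_sub, Polynomial.eval_X,
        Polynomial.eval_one, zero_sub] at this
      rw [this, Ring.choose_neg, ← Ring.multichoose_eq, Ring.multichoose_one, Int.negOnePow_def]
      simp [Units.smul_def]
    simp only [choosePred, Polynomial.coeff_X_mul, h2] at h
    rw [← Polynomial.C_eq_natCast, Polynomial.coeff_C_mul] at h
    rw [PowerSeries.coeff_log, if_neg (Nat.succ_ne_zero n)]
    have hn : ((n + 1 : ℕ) : ℝ) ≠ 0 := Nat.cast_ne_zero.2 (Nat.succ_ne_zero n)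
    rw [eq_ratCast]
    push_cast at h hn ⊢
    rw [eq_div_iff hn, mul_comm, h]
    ring

lemma coeff_one_powPolynomial {f : MvPowerSeries (Fin m) ℝ}
    (hf : MvPowerSeries.constantCoeff f = 1) (l : Fin m →₀ ℕ) :
    (powPolynomial f l).coeff 1 = MvPowerSeries.coeff l (logSeries f) := by
  rw [coeff_logSeries hf, powPolynomial, Polynomial.finsetSum_coeff]
  refine Finset.sum_congr rfl fun k _ => ?_
  rw [Polynomial.coeff_C_mul, coeff_one_choose_X, mul_comm]

lemma coeff_zero_powPolynomial {f : MvPowerSeries (Fin m) ℝ}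
    (hf : MvPowerSeries.constantCoeff f = 1) (l : Fin m →₀ ℕ) :
    (powPolynomial f l).coeff 0 = MvPowerSeries.coeff l (1 : MvPowerSeries (Fin m) ℝ) := by
  have := eval_powPolynomial hf l 0
  rw [Polynomial.coeff_zero_eq_eval_zero]
  simpa using this

/-- Compare linear terms in a of (fg)^a = f^a g^a. The constant terms are the coefficients of 1, so
the product rule leaves log f + log g. -/
lemma logSeries_mul {f g : MvPowerSeries (Fin m) ℝ} (hf : MvPowerSeries.constantCoeff f = 1)
    (hg : MvPowerSeries.constantCoeff g = 1) :
    logSeries (f * g) = logSeries f + logSeries g := by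
  ext l
  have hfg : MvPowerSeries.constantCoeff (f * g) = 1 := by rw [map_mul, hf, hg, one_mul]
  have h : powPolynomial (f * g) l =
      ∑ p ∈ antidiagonal l, powPolynomial f p.1 * powPolynomial g p.2 := by
    apply polynomial_eq_of_eval_natCast
    intro a
    rw [eval_powPolynomial hfg, Polynomial.eval_finsetSum, mul_pow, MvPowerSeries.coeff_mul]
    refine Finset.sum_congr rfl fun p _ => ?_
    rw [Polynomial.eval_mul, eval_powPolynomial hf, eval_powPolynomial hg]
  rw [← coeff_one_powPolynomial hfg, h, Polynomial.finsetSum_coeff]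
  simp only [Polynomial.mul_coeff_one, coeff_zero_powPolynomial hf, coeff_zero_powPolynomial hg,
    coeff_one_powPolynomial hf, coeff_one_powPolynomial hg, Finset.sum_add_distrib]
  rw [← MvPowerSeries.coeff_mul, ← MvPowerSeries.coeff_mul, one_mul, mul_one, map_add, add_comm]

lemma logSeries_one : logSeries (1 : MvPowerSeries (Fin m) ℝ) = 0 := by
  have h := logSeries_mul (m := m) (map_one MvPowerSeries.constantCoeff)
    (map_one MvPowerSeries.constantCoeff)
  rw [one_mul] at h
  exact left_eq_add.1 h

lemma logSeries_pow {f : MvPowerSeries (Fin m) ℝ} (hf : MvPowerSeries.constantCoeff f = 1)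
    (n : ℕ) : logSeries (f ^ n) = n • logSeries f := by
  induction n with
  | zero => simp [logSeries_one]
  | succ n ih =>
    rw [pow_succ, logSeries_mul (by rw [map_pow, hf, one_pow]) hf, ih, succ_nsmul]

lemma constantCoeff_inv_eq_one {f : MvPowerSeries (Fin m) ℝ}
    (hf : MvPowerSeries.constantCoeff f = 1) : MvPowerSeries.constantCoeff f⁻¹ = 1 := by
  rw [MvPowerSeries.constantCoeff_inv, hf, inv_one]

lemma logSeries_inv {f : MvPowerSeries (Fin m) ℝ} (hf : MvPowerSeries.constantCoeff f = 1) :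
    logSeries f⁻¹ = -logSeries f := by
  have h := logSeries_mul hf (constantCoeff_inv_eq_one hf)
  rw [MvPowerSeries.mul_inv_cancel _ (by rw [hf]; exact one_ne_zero), logSeries_one] at h
  exact (neg_eq_of_add_eq_zero_right h.symm).symm

lemma logSeries_prod {ι : Type*} (s : Finset ι) (f : ι → MvPowerSeries (Fin m) ℝ)
    (hf : ∀ i ∈ s, MvPowerSeries.constantCoeff (f i) = 1) :
    logSeries (∏ i ∈ s, f i) = ∑ i ∈ s, logSeries (f i) := by
  classical
  induction s using Finset.induction_on with
  | empty => simp [logSeries_one]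
  | insert a s ha ih =>
    have hs : ∀ i ∈ s, MvPowerSeries.constantCoeff (f i) = 1 :=
      fun i hi => hf i (Finset.mem_insert_of_mem hi)
    rw [Finset.prod_insert ha, Finset.sum_insert ha, logSeries_mul (hf a (mem_insert_self a s))
      (by rw [map_prod]; exact Finset.prod_eq_one hs), ih hs]

lemma coeff_logSeries_congr {f g : MvPowerSeries (Fin m) ℝ} {n : ℕ}
    (hf : MvPowerSeries.constantCoeff f = 1) (hg : MvPowerSeries.constantCoeff g = 1)
    (h : truncHom m n f = truncHom m n g) {l : Fin m →₀ ℕ} (hl : l.degree ≤ n) :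
    MvPowerSeries.coeff l (logSeries f) = MvPowerSeries.coeff l (logSeries g) := by
  rw [coeff_logSeries hf, coeff_logSeries hg]
  refine Finset.sum_congr rfl fun k _ => ?_
  have : truncHom m n ((f - 1) ^ k) = truncHom m n ((g - 1) ^ k) := by
    simp only [map_pow, map_sub, h]
  rw [truncHom_eq_iff.1 this l hl]

lemma constantCoeff_one_sub_monomial {d : Fin m →₀ ℕ} (hd : d ≠ 0) :
    MvPowerSeries.constantCoeff (1 - MvPowerSeries.monomial d (1 : ℝ)) = 1 := by
  rw [map_sub, map_one, ← MvPowerSeries.coeff_zero_eq_constantCoeff_apply,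
    MvPowerSeries.coeff_monomial_ne hd.symm, sub_zero]

lemma coeff_logSeries_one_sub_monomial {d : Fin m →₀ ℕ} (hd : d ≠ 0) (l : Fin m →₀ ℕ) :
    MvPowerSeries.coeff l (logSeries (1 - MvPowerSeries.monomial d (1 : ℝ))) =
      -∑ k ∈ Finset.Icc 1 l.degree, if l = k • d then (1 / k : ℝ) else 0 := by
  rw [coeff_logSeries (constantCoeff_one_sub_monomial hd), Finset.range_eq_Ico,
    Finset.sum_eq_sum_Ico_succ_bot (by omega), ← Finset.sum_neg_distrib]
  have hI : Finset.Ico (0 + 1) (l.degree + 1) = Finset.Icc 1 l.degree := rfl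
  rw [hI]
  simp only [PowerSeries.coeff_log, if_true, zero_mul, zero_add]
  refine Finset.sum_congr rfl fun k hk => ?_
  have hk0 : k ≠ 0 := by have := (Finset.mem_Icc.1 hk).1; omega
  have e : (1 - MvPowerSeries.monomial d (1 : ℝ) - 1) ^ k =
      MvPowerSeries.monomial (k • d) ((-1 : ℝ) ^ k) := by
    rw [sub_sub_cancel_left, ← map_neg, MvPowerSeries.monomial_pow]
  rw [e, MvPowerSeries.coeff_monomial, if_neg hk0, eq_ratCast]
  split_ifs with h
  · push_cast
    have : ((-1 : ℝ) ^ k) * (-1) ^ k = 1 := by rw [← mul_pow]; simp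
    rw [pow_succ, div_mul_eq_mul_div, ← neg_div]
    congr 1
    linear_combination -this
  · simp

lemma constantCoeff_eulerFactor {d : Fin m →₀ ℕ} (hd : d ≠ 0) (n : ℤ) :
    MvPowerSeries.constantCoeff (eulerFactor d n) = 1 := by
  have h := constantCoeff_one_sub_monomial hd
  rw [eulerFactor, map_mul, map_pow, map_pow, h, constantCoeff_inv_eq_one h]
  simp

lemma logSeries_eulerFactor {d : Fin m →₀ ℕ} (hd : d ≠ 0) (n : ℤ) :
    logSeries (eulerFactor d n) =
      n • logSeries (1 - MvPowerSeries.monomial d (1 : ℝ)) := by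
  have h := constantCoeff_one_sub_monomial hd
  have h' := constantCoeff_inv_eq_one h
  rw [eulerFactor, logSeries_mul (by rw [map_pow, h, one_pow]) (by rw [map_pow, h', one_pow]),
    logSeries_pow h, logSeries_pow h', logSeries_inv h]
  rw [← natCast_zsmul, ← natCast_zsmul, zsmul_neg, ← sub_eq_add_neg, ← sub_smul,
    Int.toNat_sub_toNat_neg]

end Logarithm

/-! ### Euler products of integral series and Möbius inversion -/

section EulerProduct

variable {m : ℕ}

/-- The exponent vectors of degree `n`. -/
def vectorsOfDegree (m n : ℕ) : Finset (Fin m →₀ ℕ) :=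
  Finset.finsuppAntidiag univ n

lemma mem_vectorsOfDegree {n : ℕ} {d : Fin m →₀ ℕ} : d ∈ vectorsOfDegree m n ↔ d.degree = n := by
  simp [vectorsOfDegree, Finsupp.degree_eq_sum]

/-- The nonzero exponent vectors of degree at most `n`. -/
def vectorsUpTo (m n : ℕ) : Finset (Fin m →₀ ℕ) :=
  (range n).biUnion fun k => vectorsOfDegree m (k + 1)

lemma mem_vectorsUpTo {n : ℕ} {d : Fin m →₀ ℕ} :
    d ∈ vectorsUpTo m n ↔ d ≠ 0 ∧ d.degree ≤ n := by
  simp only [vectorsUpTo, mem_biUnion, mem_range, mem_vectorsOfDegree]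
  constructor
  · rintro ⟨k, hk, h⟩
    refine ⟨?_, by omega⟩
    rintro rfl
    simp at h
  · rintro ⟨h0, h⟩
    have : d.degree ≠ 0 := fun h' => h0 ((Finsupp.degree_eq_zero_iff d).1 h')
    exact ⟨d.degree - 1, by omega, by omega⟩

lemma vectorsUpTo_succ (n : ℕ) :
    vectorsUpTo m (n + 1) = vectorsUpTo m n ∪ vectorsOfDegree m (n + 1) := by
  rw [vectorsUpTo, Finset.range_add_one, Finset.biUnion_insert, Finset.union_comm]
  rfl

lemma disjoint_vectorsUpTo (n : ℕ) :
    Disjoint (vectorsUpTo m n) (vectorsOfDegree m (n + 1)) := by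
  rw [Finset.disjoint_left]
  intro d h h'
  rw [mem_vectorsUpTo] at h
  rw [mem_vectorsOfDegree] at h'
  omega

lemma truncHom_eq_zero_iff {n : ℕ} {f : MvPowerSeries (Fin m) ℝ} :
    truncHom m n f = 0 ↔ f ∈ highDegreeIdeal m n :=
  Ideal.Quotient.eq_zero_iff_mem

lemma monomial_mem_highDegreeIdeal {d : Fin m →₀ ℕ} {n : ℕ} (h : n < d.degree) (a : ℝ) :
    MvPowerSeries.monomial d a ∈ highDegreeIdeal m n := by
  intro l hl
  refine MvPowerSeries.coeff_monomial_ne ?_ a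
  rintro rfl
  omega

lemma mul_mem_highDegreeIdeal_succ {f g : MvPowerSeries (Fin m) ℝ} {n : ℕ}
    (hf : f ∈ highDegreeIdeal m n) (hg : g ∈ highDegreeIdeal m n) :
    f * g ∈ highDegreeIdeal m (n + 1) := by
  intro l hl
  rw [MvPowerSeries.coeff_mul]
  refine Finset.sum_eq_zero fun p hp => ?_
  rw [← Finset.HasAntidiagonal.mem_antidiagonal.1 hp, map_add] at hl
  by_cases h : p.1.degree ≤ n
  · rw [hf p.1 h, zero_mul]
  · rw [hg p.2 (by omega), mul_zero]

lemma one_sub_pow_of_sq_eq_zero {R : Type*} [CommRing R] {u : R} (hu : u * u = 0) (k : ℕ) :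
    (1 - u) ^ k = 1 - k * u := by
  induction k with
  | zero => simp
  | succ k ih =>
    rw [pow_succ, ih]
    push_cast
    linear_combination (k : R) * hu

lemma one_add_pow_of_sq_eq_zero {R : Type*} [CommRing R] {u : R} (hu : u * u = 0) (k : ℕ) :
    (1 + u) ^ k = 1 + k * u := by
  have h := one_sub_pow_of_sq_eq_zero (u := -u) (by rw [neg_mul_neg, hu]) k
  rwa [sub_neg_eq_add, mul_neg, sub_neg_eq_add] at h

/-- Since x^{2d} is truncated away, u = x^d squares to zero, and (1 - u)^k = 1 - ku for every
integer k. -/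
lemma truncHom_eulerFactor {d : Fin m →₀ ℕ} (hd : d ≠ 0) {n : ℕ}
    (h : n < 2 * d.degree) (k : ℤ) :
    truncHom m n (eulerFactor d k) =
      1 - (k : MvPowerSeries (Fin m) ℝ ⧸ highDegreeIdeal m n) *
        truncHom m n (MvPowerSeries.monomial d 1) := by
  set u := truncHom m n (MvPowerSeries.monomial d 1) with hu
  have hsq : u * u = 0 := by
    rw [hu, ← map_mul, MvPowerSeries.monomial_mul_monomial, truncHom_eq_zero_iff]
    apply monomial_mem_highDegreeIdeal
    rw [map_add]
    omega
  have hinv : truncHom m n (1 - MvPowerSeries.monomial d (1 : ℝ))⁻¹ = 1 + u := by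
    have h1 : (1 - MvPowerSeries.monomial d (1 : ℝ))⁻¹ * (1 - MvPowerSeries.monomial d (1 : ℝ)) =
        1 := MvPowerSeries.inv_mul_cancel _ (by
          rw [constantCoeff_one_sub_monomial hd]; exact one_ne_zero)
    have h2 := congrArg (truncHom m n) h1
    rw [map_mul, map_sub, map_one (truncHom m n), ← hu] at h2
    linear_combination (1 + u) * h2 +
      truncHom m n (1 - MvPowerSeries.monomial d (1 : ℝ))⁻¹ * hsq
  rw [eulerFactor, map_mul, map_pow, map_pow, map_sub, map_one (truncHom m n), ← hu, hinv,
    one_sub_pow_of_sq_eq_zero hsq, one_add_pow_of_sq_eq_zero hsq]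
  have hk : (k : MvPowerSeries (Fin m) ℝ ⧸ highDegreeIdeal m n) =
      (k.toNat : MvPowerSeries (Fin m) ℝ ⧸ highDegreeIdeal m n) - (-k).toNat := by
    conv_lhs => rw [← Int.toNat_sub_toNat_neg k]
    push_cast
    rfl
  rw [hk]
  linear_combination -((k.toNat : MvPowerSeries (Fin m) ℝ ⧸ highDegreeIdeal m n) *
    (-k).toNat) * hsq

lemma truncHom_eulerFactor_of_lt {d : Fin m →₀ ℕ} {n : ℕ} (h : n < d.degree) (k : ℤ) :
    truncHom m n (eulerFactor d k) = 1 := by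
  have hd : d ≠ 0 := by rintro rfl; simp at h
  rw [truncHom_eulerFactor hd (by omega), truncHom_eq_zero_iff.2 (monomial_mem_highDegreeIdeal h 1),
    mul_zero, sub_zero]

lemma eulerFactor_mul_eulerFactor_neg {d : Fin m →₀ ℕ} (hd : d ≠ 0) (k : ℤ) :
    eulerFactor d k * eulerFactor d (-k) = 1 := by
  have h1 : (1 - MvPowerSeries.monomial d (1 : ℝ)) * (1 - MvPowerSeries.monomial d (1 : ℝ))⁻¹ =
      1 := MvPowerSeries.mul_inv_cancel _ (by
        rw [constantCoeff_one_sub_monomial hd]; exact one_ne_zero)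
  rw [eulerFactor, eulerFactor, neg_neg, mul_comm ((1 - MvPowerSeries.monomial d 1) ^ (-k).toNat),
    mul_mul_mul_comm, ← mul_pow, ← mul_pow, h1, mul_comm, mul_comm (_⁻¹), h1]
  simp

/-- The subring of the power series with integral coefficients. -/
noncomputable def integralSeries (m : ℕ) : Subring (MvPowerSeries (Fin m) ℝ) :=
  (MvPowerSeries.map (σ := Fin m) (Int.castRingHom ℝ)).range

lemma mem_integralSeries {f : MvPowerSeries (Fin m) ℝ} :
    f ∈ integralSeries m ↔ ∀ l, ∃ z : ℤ, MvPowerSeries.coeff l f = z := by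
  constructor
  · rintro ⟨g, rfl⟩ l
    exact ⟨MvPowerSeries.coeff l g, by simp⟩
  · intro h
    choose z hz using h
    refine ⟨(z : MvPowerSeries (Fin m) ℤ), ?_⟩
    ext l
    rw [hz]
    exact MvPowerSeries.coeff_map _ _ _

lemma eulerFactor_mem_integralSeries {d : Fin m →₀ ℕ} (hd : d ≠ 0) (k : ℤ) :
    eulerFactor d k ∈ integralSeries m := by
  have h0 : MvPowerSeries.constantCoeff (1 - MvPowerSeries.monomial d (1 : ℤ)) = 1 := by
    rw [map_sub, map_one, ← MvPowerSeries.coeff_zero_eq_constantCoeff_apply,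
      MvPowerSeries.coeff_monomial_ne hd.symm, sub_zero]
  have h1 := MvPowerSeries.mul_invOfUnit (1 - MvPowerSeries.monomial d (1 : ℤ)) 1 h0
  have h2 : MvPowerSeries.map (Int.castRingHom ℝ) (1 - MvPowerSeries.monomial d (1 : ℤ)) =
      1 - MvPowerSeries.monomial d (1 : ℝ) := by
    rw [map_sub, map_one (MvPowerSeries.map (Int.castRingHom ℝ)), MvPowerSeries.map_monomial,
      map_one (Int.castRingHom ℝ)]
  have h3 := congrArg (MvPowerSeries.map (Int.castRingHom ℝ)) h1
  rw [map_mul, h2, map_one (MvPowerSeries.map (Int.castRingHom ℝ)), mul_comm] at h3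
  have h4 := (MvPowerSeries.eq_inv_iff_mul_eq_one (by
    rw [constantCoeff_one_sub_monomial hd]; exact one_ne_zero)).2 h3
  have h5 : 1 - MvPowerSeries.monomial d (1 : ℝ) ∈ integralSeries m := ⟨_, h2⟩
  have h6 : (1 - MvPowerSeries.monomial d (1 : ℝ))⁻¹ ∈ integralSeries m := ⟨_, h4⟩
  exact Subring.mul_mem _ (Subring.pow_mem _ h5 _) (Subring.pow_mem _ h6 _)

/-- The series left over from `y` when the Euler factors up to degree `n` have been divided off. -/
noncomputable def eulerRemainder (y : MvPowerSeries (Fin m) ℝ) : ℕ → MvPowerSeries (Fin m) ℝ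
  | 0 => y
  | n + 1 => eulerRemainder y n *
      ∏ d ∈ vectorsOfDegree m (n + 1), eulerFactor d ⌊MvPowerSeries.coeff d (eulerRemainder y n)⌋

/-- The exponents of the Euler product of `y`. -/
noncomputable def eulerExponent (y : MvPowerSeries (Fin m) ℝ) (d : Fin m →₀ ℕ) : ℤ :=
  -⌊MvPowerSeries.coeff d (eulerRemainder y (d.degree - 1))⌋

lemma ne_zero_of_mem_vectorsOfDegree {n : ℕ} {d : Fin m →₀ ℕ}
    (h : d ∈ vectorsOfDegree m (n + 1)) : d ≠ 0 := by
  rintro rfl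
  simp [mem_vectorsOfDegree] at h

lemma eulerRemainder_mul_prod (y : MvPowerSeries (Fin m) ℝ) (n : ℕ) :
    eulerRemainder y n * ∏ d ∈ vectorsUpTo m n, eulerFactor d (eulerExponent y d) = y := by
  induction n with
  | zero => simp [vectorsUpTo, eulerRemainder]
  | succ n ih =>
    conv_rhs => rw [← ih]
    have h : (∏ d ∈ vectorsOfDegree m (n + 1),
        eulerFactor d ⌊MvPowerSeries.coeff d (eulerRemainder y n)⌋) *
        ∏ d ∈ vectorsOfDegree m (n + 1), eulerFactor d (eulerExponent y d) = 1 := by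
      rw [← Finset.prod_mul_distrib]
      refine Finset.prod_eq_one fun d hd => ?_
      have hdeg := mem_vectorsOfDegree.1 hd
      rw [eulerExponent, hdeg, Nat.add_sub_cancel]
      exact eulerFactor_mul_eulerFactor_neg (ne_zero_of_mem_vectorsOfDegree hd) _
    rw [vectorsUpTo_succ, Finset.prod_union (disjoint_vectorsUpTo n), eulerRemainder]
    linear_combination (eulerRemainder y n *
      ∏ d ∈ vectorsUpTo m n, eulerFactor d (eulerExponent y d)) * h

lemma eulerRemainder_mem_integralSeries {y : MvPowerSeries (Fin m) ℝ} (hy : y ∈ integralSeries m)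
    (n : ℕ) : eulerRemainder y n ∈ integralSeries m := by
  induction n with
  | zero => exact hy
  | succ n ih =>
    exact Subring.mul_mem _ ih (Subring.prod_mem _ fun d hd =>
      eulerFactor_mem_integralSeries (ne_zero_of_mem_vectorsOfDegree hd) _)

lemma truncHom_prod_eulerFactor (n : ℕ) (a : (Fin m →₀ ℕ) → ℤ) (s : Finset (Fin m →₀ ℕ))
    (hs : s ⊆ vectorsOfDegree m (n + 1)) :
    truncHom m (n + 1) (∏ d ∈ s, eulerFactor d (a d)) =
      1 - truncHom m (n + 1) (∑ d ∈ s, MvPowerSeries.monomial d (a d : ℝ)) := by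
  induction s using Finset.induction_on with
  | empty => simp
  | insert d s hd ih =>
    have hdeg := mem_vectorsOfDegree.1 (hs (mem_insert_self d s))
    have hs' : s ⊆ vectorsOfDegree m (n + 1) := (Finset.subset_insert d s).trans hs
    have e : truncHom m (n + 1) (eulerFactor d (a d)) =
        1 - truncHom m (n + 1) (MvPowerSeries.monomial d (a d : ℝ)) := by
      rw [truncHom_eulerFactor (ne_zero_of_mem_vectorsOfDegree (hs (mem_insert_self d s)))
        (by omega), ← map_intCast (truncHom m (n + 1)), ← map_mul]
      congr 2
      rw [← zsmul_eq_mul, ← map_zsmul, zsmul_one]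
    have h0 : truncHom m (n + 1) (MvPowerSeries.monomial d (a d : ℝ)) *
        truncHom m (n + 1) (∑ d ∈ s, MvPowerSeries.monomial d (a d : ℝ)) = 0 := by
      rw [← map_mul, truncHom_eq_zero_iff]
      apply mul_mem_highDegreeIdeal_succ
      · exact monomial_mem_highDegreeIdeal (by omega) _
      · refine Ideal.sum_mem _ fun d' hd' => monomial_mem_highDegreeIdeal ?_ _
        have := mem_vectorsOfDegree.1 (hs' hd')
        omega
    rw [Finset.prod_insert hd, map_mul, ih hs', e, Finset.sum_insert hd, map_add]
    linear_combination h0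

lemma coeff_sum_monomial (s : Finset (Fin m →₀ ℕ)) (a : (Fin m →₀ ℕ) → ℝ) (l : Fin m →₀ ℕ) :
    MvPowerSeries.coeff l (∑ d ∈ s, MvPowerSeries.monomial d (a d)) =
      if l ∈ s then a l else 0 := by
  simp [map_sum, MvPowerSeries.coeff_monomial]

/-- Let A be the part of degree n + 1 of the remainder. Modulo higher degrees the remainder is 1 +
A, the new factors multiply to 1 - A, and A² = 0. -/
lemma truncHom_eulerRemainder {y : MvPowerSeries (Fin m) ℝ} (hy : y ∈ integralSeries m)
    (hy1 : MvPowerSeries.constantCoeff y = 1) (n : ℕ) :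
    truncHom m n (eulerRemainder y n) = 1 := by
  induction n with
  | zero =>
    rw [← map_one (truncHom m 0), truncHom_eq_iff]
    intro l hl
    obtain rfl : l = 0 := (Finsupp.degree_eq_zero_iff l).1 (by omega)
    simpa [eulerRemainder] using hy1
  | succ n ih =>
    set F := eulerRemainder y n with hF
    set A := ∑ d ∈ vectorsOfDegree m (n + 1),
      MvPowerSeries.monomial d ((⌊MvPowerSeries.coeff d F⌋ : ℤ) : ℝ) with hA
    have hcoeff : ∀ l : Fin m →₀ ℕ, l.degree ≤ n →
        MvPowerSeries.coeff l F = MvPowerSeries.coeff l (1 : MvPowerSeries (Fin m) ℝ) :=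
      truncHom_eq_iff.1 (ih.trans (map_one _).symm)
    have h1 : truncHom m (n + 1) F = 1 + truncHom m (n + 1) A := by
      rw [← map_one (truncHom m (n + 1)), ← map_add, truncHom_eq_iff]
      intro l hl
      rw [map_add, hA, coeff_sum_monomial]
      by_cases hln : l.degree ≤ n
      · rw [if_neg (by rw [mem_vectorsOfDegree]; omega), add_zero, hcoeff l hln]
      · have hl' : l.degree = n + 1 := by omega
        -- Integrality makes the floor in the exponent exact.
        obtain ⟨z, hz⟩ := mem_integralSeries.1 (eulerRemainder_mem_integralSeries hy n) l
        rw [← hF] at hz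
        have h0 : l ≠ 0 := by rintro rfl; simp at hl'
        rw [if_pos (mem_vectorsOfDegree.2 hl'), hz, Int.floor_intCast, MvPowerSeries.coeff_one,
          if_neg h0, zero_add]
    have h2 : truncHom m (n + 1) A * truncHom m (n + 1) A = 0 := by
      have hmem : A ∈ highDegreeIdeal m n := Ideal.sum_mem _ fun d hd =>
        monomial_mem_highDegreeIdeal (by have := mem_vectorsOfDegree.1 hd; omega) _
      rw [← map_mul, truncHom_eq_zero_iff]
      exact mul_mem_highDegreeIdeal_succ hmem hmem
    rw [eulerRemainder, map_mul, ← hF, h1,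
      truncHom_prod_eulerFactor n (fun d => ⌊MvPowerSeries.coeff d F⌋) _ subset_rfl, ← hA]
    linear_combination -h2

/-- The nonzero exponent vectors of degree at most `n`, as a subset of the index set of the Euler
product. -/
def eulerIndex (m n : ℕ) : Finset {d : Fin m →₀ ℕ // d ≠ 0} :=
  (vectorsUpTo m n).subtype (· ≠ 0)

lemma mem_eulerIndex {n : ℕ} {d : {d : Fin m →₀ ℕ // d ≠ 0}} :
    d ∈ eulerIndex m n ↔ d.1.degree ≤ n := by
  simp [eulerIndex, mem_vectorsUpTo, d.2]

lemma truncHom_prod_of_eulerIndex_subset (Ω : {d : Fin m →₀ ℕ // d ≠ 0} → ℤ) {n : ℕ}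
    {s : Finset {d : Fin m →₀ ℕ // d ≠ 0}} (hs : eulerIndex m n ⊆ s) :
    truncHom m n (∏ d ∈ s, eulerFactor d.1 (Ω d)) =
      truncHom m n (∏ d ∈ eulerIndex m n, eulerFactor d.1 (Ω d)) := by
  rw [map_prod, map_prod]
  refine (Finset.prod_subset hs fun d _ hd => ?_).symm
  rw [mem_eulerIndex, not_le] at hd
  exact truncHom_eulerFactor_of_lt hd _

/-- Factors with deg d > n are 1 modulo degrees above n, so each coefficient of the partial products
is eventually constant; convergence becomes a finite condition in each degree. -/
lemma isDTFamily_iff (y : MvPowerSeries (Fin m) ℝ) (Ω : {d : Fin m →₀ ℕ // d ≠ 0} → ℤ) :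
    IsDTFamily y Ω ↔ ∀ n,
      truncHom m n y = truncHom m n (∏ d ∈ eulerIndex m n, eulerFactor d.1 (Ω d)) := by
  rw [IsDTFamily, HasProd, SummationFilter.unconditional_filter,
    MvPowerSeries.WithPiTopology.tendsto_iff_coeff_tendsto]
  have hev : ∀ n (l : Fin m →₀ ℕ), l.degree ≤ n →
      (fun s : Finset {d : Fin m →₀ ℕ // d ≠ 0} =>
        MvPowerSeries.coeff l (∏ d ∈ s, eulerFactor d.1 (Ω d))) =ᶠ[atTop]
      fun _ => MvPowerSeries.coeff l (∏ d ∈ eulerIndex m n, eulerFactor d.1 (Ω d)) := by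
    intro n l hl
    filter_upwards [eventually_ge_atTop (eulerIndex m n)] with s hs
    exact truncHom_eq_iff.1 (truncHom_prod_of_eulerIndex_subset Ω hs) l hl
  constructor
  · intro h n
    rw [truncHom_eq_iff]
    intro l hl
    exact tendsto_nhds_unique ((h l).congr' (hev n l hl)) tendsto_const_nhds
  · intro h l
    rw [truncHom_eq_iff.1 (h l.degree) l le_rfl]
    exact tendsto_const_nhds.congr' (hev l.degree l le_rfl).symm

lemma exists_isDTFamily {y : MvPowerSeries (Fin m) ℝ} (hy : y ∈ integralSeries m)
    (hy1 : MvPowerSeries.constantCoeff y = 1) :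
    ∃ Ω : {d : Fin m →₀ ℕ // d ≠ 0} → ℤ, IsDTFamily y Ω := by
  refine ⟨fun d => eulerExponent y d.1, (isDTFamily_iff _ _).2 fun n => ?_⟩
  conv_lhs => rw [← eulerRemainder_mul_prod y n]
  rw [map_mul, truncHom_eulerRemainder hy hy1, one_mul]
  congr 1
  exact (Finset.prod_subtype_of_mem (fun d => eulerFactor d (eulerExponent y d))
    fun d hd => (mem_vectorsUpTo.1 hd).1).symm

/-- The value of `Ω`, extended by `0`. -/
noncomputable def extendByZero (Ω : {d : Fin m →₀ ℕ // d ≠ 0} → ℤ) (d : Fin m →₀ ℕ) : ℤ :=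
  open Classical in if h : d ≠ 0 then Ω ⟨d, h⟩ else 0

lemma dvd_gcd_iff {l : Fin m →₀ ℕ} {k : ℕ} : k ∣ univ.gcd l ↔ ∀ i, k ∣ l i := by
  simp [Finset.dvd_gcd_iff]

lemma gcd_ne_zero {l : Fin m →₀ ℕ} (hl : l ≠ 0) : univ.gcd l ≠ 0 := by
  intro h
  apply hl
  ext i
  exact Finset.gcd_eq_zero_iff.1 h i (Finset.mem_univ i)

lemma smul_divVec {l : Fin m →₀ ℕ} {k : ℕ} (h : k ∣ univ.gcd l) : k • divVec l k = l := by
  ext i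
  simp [divVec, Nat.mul_div_cancel' (dvd_gcd_iff.1 h i)]

lemma divVec_smul {d : Fin m →₀ ℕ} {k : ℕ} (hk : 0 < k) : divVec (k • d) k = d := by
  ext i
  simp [divVec, Nat.mul_div_cancel_left _ hk]

lemma divVec_ne_zero {l : Fin m →₀ ℕ} (hl : l ≠ 0) {k : ℕ} (h : k ∣ univ.gcd l) :
    divVec l k ≠ 0 := by
  intro h0
  apply hl
  rw [← smul_divVec h, h0, smul_zero]

/-- In ∑ Ω_d log(1 - x^d) only the vectors d = l/k contribute to x^l, each with -Ω_d/k. -/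
lemma coeff_logSeries_of_isDTFamily {y : MvPowerSeries (Fin m) ℝ}
    (hy1 : MvPowerSeries.constantCoeff y = 1) {Ω : {d : Fin m →₀ ℕ // d ≠ 0} → ℤ}
    (h : IsDTFamily y Ω) {l : Fin m →₀ ℕ} (hl : l ≠ 0) :
    MvPowerSeries.coeff l (logSeries y) =
      -∑ k ∈ (univ.gcd l).divisors, (extendByZero Ω (divVec l k) : ℝ) / k := by
  have hc : MvPowerSeries.constantCoeff
      (∏ d ∈ eulerIndex m l.degree, eulerFactor d.1 (Ω d)) = 1 := by
    rw [map_prod]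
    exact Finset.prod_eq_one fun d _ => constantCoeff_eulerFactor d.2 _
  rw [coeff_logSeries_congr hy1 hc ((isDTFamily_iff y Ω).1 h l.degree) le_rfl,
    logSeries_prod _ _ fun d _ => constantCoeff_eulerFactor d.2 _, map_sum]
  have hterm : ∀ d ∈ eulerIndex m l.degree,
      MvPowerSeries.coeff l (logSeries (eulerFactor d.1 (Ω d))) =
        -∑ k ∈ Finset.Icc 1 l.degree, if l = k • d.1 then (Ω d : ℝ) / k else 0 := by
    intro d _
    rw [logSeries_eulerFactor d.2, map_zsmul, coeff_logSeries_one_sub_monomial d.2, zsmul_eq_mul,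
      mul_neg, Finset.mul_sum]
    congr 1
    refine Finset.sum_congr rfl fun k _ => ?_
    split_ifs <;> ring
  rw [Finset.sum_congr rfl hterm, Finset.sum_neg_distrib, Finset.sum_comm]
  congr 1
  have hdiv : (univ.gcd l).divisors ⊆ Finset.Icc 1 l.degree := by
    intro k hk
    have hk' := Nat.dvd_of_mem_divisors hk
    have hpos := Nat.pos_of_mem_divisors hk
    rw [Finset.mem_Icc]
    refine ⟨hpos, ?_⟩
    have hdd : (divVec l k).degree ≠ 0 := fun h' =>
      divVec_ne_zero hl hk' ((Finsupp.degree_eq_zero_iff _).1 h')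
    conv_rhs => rw [← smul_divVec hk', map_nsmul, smul_eq_mul]
    exact Nat.le_mul_of_pos_right k (Nat.pos_of_ne_zero hdd)
  rw [← Finset.sum_subset hdiv]
  · refine Finset.sum_congr rfl fun k hk => ?_
    have hk' := Nat.dvd_of_mem_divisors hk
    have hpos := Nat.pos_of_mem_divisors hk
    have hne := divVec_ne_zero hl hk'
    rw [Finset.sum_eq_single (⟨divVec l k, hne⟩ : {d : Fin m →₀ ℕ // d ≠ 0})]
    · rw [if_pos (smul_divVec hk').symm, extendByZero, dif_pos hne]
    · intro d _ hd
      rw [if_neg]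
      intro h'
      apply hd
      ext1
      exact ((congrArg (fun v => divVec v k) h').trans (divVec_smul hpos)).symm
    · intro h'
      exfalso
      apply h'
      rw [mem_eulerIndex]
      conv_rhs => rw [← smul_divVec hk', map_nsmul, smul_eq_mul]
      exact Nat.le_mul_of_pos_left _ hpos
  · intro k _ hk
    refine Finset.sum_eq_zero fun d _ => if_neg fun h' => hk ?_
    rw [Nat.mem_divisors]
    refine ⟨dvd_gcd_iff.2 fun i => ?_, gcd_ne_zero hl⟩
    rw [h']
    simp

lemma gcd_smul (d : Fin m →₀ ℕ) (k : ℕ) : univ.gcd (k • d) = k * univ.gcd d := by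
  have := Finset.gcd_mul_left (s := (univ : Finset (Fin m))) (f := d) (a := k)
  rw [normalize_eq] at this
  rw [← this]
  rfl

theorem isDTFamily_eq_moebius_sum {y : MvPowerSeries (Fin m) ℝ}
    (hy1 : MvPowerSeries.constantCoeff y = 1) {Ω : {d : Fin m →₀ ℕ // d ≠ 0} → ℤ}
    (h : IsDTFamily y Ω) (d : {d : Fin m →₀ ℕ // d ≠ 0}) :
    (Ω d : ℝ) = -∑ n ∈ (univ.gcd d.1).divisors, (ArithmeticFunction.moebius n : ℝ) / (n : ℝ) *
      MvPowerSeries.coeff (divVec d.1 n) (logSeries y) := by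
  obtain ⟨l, hl⟩ := d
  set g := univ.gcd l with hg
  have hg0 : g ≠ 0 := gcd_ne_zero hl
  set r := divVec l g with hr
  have hlr : g • r = l := smul_divVec dvd_rfl
  have hr0 : r ≠ 0 := divVec_ne_zero hl dvd_rfl
  have hgr : univ.gcd r = 1 := by
    have h1 := gcd_smul r g
    rw [hlr, ← hg] at h1
    exact Nat.eq_of_mul_eq_mul_left (Nat.pos_of_ne_zero hg0) (by rw [← h1, mul_one])
  have hdiv : ∀ k, k ∣ g → divVec l k = (g / k) • r := by
    intro k hk
    have hkpos : 0 < k := Nat.pos_of_dvd_of_pos hk (Nat.pos_of_ne_zero hg0)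
    conv_lhs => rw [← hlr, ← Nat.mul_div_cancel' hk, mul_smul, divVec_smul hkpos]
  -- On the ray of multiples n • r of the primitive vector r, scaling by n turns the divisor formula
  -- for log y into ∑_{k ∣ n} k Ω_{k r} = -n c_{n r}, the standard form for Möbius inversion.
  have key := (ArithmeticFunction.sum_eq_iff_sum_mul_moebius_eq
    (f := fun n => (n : ℝ) * extendByZero Ω (n • r))
    (g := fun n => -(n : ℝ) * MvPowerSeries.coeff (n • r) (logSeries y))).1 (by
      intro n hn
      have hnr : n • r ≠ 0 := smul_ne_zero hn.ne' hr0
      have hgn : univ.gcd (n • r) = n := by rw [gcd_smul, hgr, mul_one]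
      rw [coeff_logSeries_of_isDTFamily hy1 h hnr, hgn, neg_mul_neg, Finset.mul_sum,
        ← Nat.sum_div_divisors]
      refine Finset.sum_congr rfl fun k hk => ?_
      have hk' := Nat.dvd_of_mem_divisors hk
      have hkpos := Nat.pos_of_mem_divisors hk
      have e : divVec (n • r) k = (n / k) • r := by
        conv_lhs => rw [← Nat.mul_div_cancel' hk', mul_smul, divVec_smul hkpos]
      rw [e, Nat.cast_div hk' (by exact_mod_cast hkpos.ne')]
      ring) g (Nat.pos_of_ne_zero hg0)
  rw [hlr, extendByZero, dif_pos hl] at key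
  have hgR : (g : ℝ) ≠ 0 := Nat.cast_ne_zero.2 hg0
  apply mul_left_cancel₀ hgR
  rw [← key, Nat.sum_divisorsAntidiagonal (f := fun a b => (ArithmeticFunction.moebius a : ℝ) *
    (-(b : ℝ) * MvPowerSeries.coeff (b • r) (logSeries y))), mul_neg, Finset.mul_sum,
    ← Finset.sum_neg_distrib]
  refine Finset.sum_congr rfl fun k hk => ?_
  have hk' := Nat.dvd_of_mem_divisors hk
  have hkpos := Nat.pos_of_mem_divisors hk
  rw [hdiv k hk', Nat.cast_div hk' (by exact_mod_cast hkpos.ne')]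
  ring

end EulerProduct

/-! ### The explicit coefficients of the logarithm -/

section LogCoefficient

variable {m : ℕ}

/-- The polynomial in `a` which interpolates, up to sign, the coefficients of `x ^ l` in the powers
`y ^ a`, for a real matrix. -/
noncomputable def lagrangePolynomial (l : Fin m →₀ ℕ) (M : Matrix (Fin m) (Fin m) ℝ) :
    Polynomial ℝ :=
  (lagrangeMatrix (M.map Polynomial.C)
    (fun i => Polynomial.X + Polynomial.C (linForm M l i)) l).det

/-- Both sides are polynomials in a that take the value of the coefficient of y^a at every natural
number a. -/
lemma powPolynomial_limitSeries (C : Matrix (Fin m) (Fin m) ℕ) (hC : C.IsSymm)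
    (l : Fin m →₀ ℕ) :
    powPolynomial (limitSeries C fun _ => 1) l =
      Polynomial.C ((-1) ^ signExponent C l) * lagrangePolynomial l (realMatrix C) := by
  apply polynomial_eq_of_eval_natCast
  intro a
  rw [eval_powPolynomial (constantCoeff_limitSeries C _), ← limitSeries_const_pow C hC,
    coeff_limitSeries, Polynomial.eval_mul, Polynomial.eval_C, lagrangeCoeff, lagrangePolynomial]
  congr 1
  have h := map_det_lagrangeMatrix (Polynomial.evalRingHom (a : ℝ))
    ((realMatrix C).map Polynomial.C)
    (fun i => Polynomial.X + Polynomial.C (linForm (realMatrix C) l i)) l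
  rw [Polynomial.coe_evalRingHom] at h
  rw [h]
  congr 2
  · ext i j
    simp
  · ext i
    simp

lemma coeff_logSeries_limitSeries (C : Matrix (Fin m) (Fin m) ℕ) (hC : C.IsSymm)
    (l : Fin m →₀ ℕ) :
    MvPowerSeries.coeff l (logSeries (limitSeries C fun _ => 1)) =
      (-1) ^ signExponent C l * (lagrangePolynomial l (realMatrix C)).coeff 1 := by
  rw [← coeff_one_powPolynomial (constantCoeff_limitSeries C _), powPolynomial_limitSeries C hC,
    Polynomial.coeff_C_mul]

lemma Amax_eq_sum (M : Matrix (Fin m) (Fin m) ℝ) (l : Fin m →₀ ℕ) :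
    Amax M l = ∑ S ∈ admissibleSets m (m - 1), ∏ e ∈ S, (M e.1 e.2 * (l e.1 : ℝ)) := by
  simp [Amax, polyAmax, map_sum, map_prod]

/-- Multiply row i by s_i. Absorption replaces s_i binom(s_i - 1, l_i - 1) by l_i binom(s_i, l_i),
so binom(s_i, l_i) factors out of the row and a shifted Laplacian with weights M_ij l_i remains. -/
lemma prod_linForm_mul_lagrangePolynomial (l : Fin m →₀ ℕ) (M : Matrix (Fin m) (Fin m) ℝ) :
    (∏ i, (Polynomial.X + Polynomial.C (linForm M l i))) * lagrangePolynomial l M =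
      (∏ i, Ring.choose (Polynomial.X + Polynomial.C (linForm M l i)) (l i)) *
        (Matrix.diagonal (fun j => Polynomial.X + ∑ k, Polynomial.C (M k j * (l k : ℝ))) -
          Matrix.of fun i j => Polynomial.C (M i j * (l i : ℝ))).det := by
  rw [lagrangePolynomial, ← Matrix.det_diagonal, ← Matrix.det_diagonal, ← Matrix.det_mul,
    ← Matrix.det_mul]
  congr 1
  ext1 i j
  have h := natCast_mul_choose (Polynomial.X + Polynomial.C (linForm M l i)) (l i)
  have e : Polynomial.X + ∑ k, Polynomial.C (M k i * (l k : ℝ)) =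
      Polynomial.X + Polynomial.C (linForm M l i) := by
    rw [linForm, map_sum]
  rw [Matrix.diagonal_mul, Matrix.diagonal_mul, lagrangeMatrix, Matrix.sub_apply,
    Matrix.diagonal_apply, Matrix.map_apply, Matrix.of_apply, e, map_mul, map_natCast]
  split_ifs
  · linear_combination (Polynomial.C (M i j)) * h
  · linear_combination (Polynomial.C (M i j)) * h

/-- A forest with m - k edges contributes to X^k. No forest has m edges when m > 0, and those with m
- 1 edges make up A_max. -/
lemma coeff_det_laplacian (hm : 0 < m) (l : Fin m →₀ ℕ) (M : Matrix (Fin m) (Fin m) ℝ) :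
    let D := (Matrix.diagonal (fun j => Polynomial.X + ∑ k, Polynomial.C (M k j * (l k : ℝ))) -
      Matrix.of fun i j => Polynomial.C (M i j * (l i : ℝ))).det
    D.coeff 0 = 0 ∧ D.coeff 1 = Amax M l := by
  classical
  intro D
  have hD : D = ∑ S : Finset (Fin m × Fin m) with IsAdmissible S,
      Polynomial.X ^ (m - S.card) * ∏ e ∈ S, Polynomial.C (M e.1 e.2 * (l e.1 : ℝ)) :=
    det_add_laplacian Polynomial.X (Matrix.of fun i j => Polynomial.C (M i j * (l i : ℝ)))
  have hk : ∀ k, D.coeff k = ∑ S : Finset (Fin m × Fin m) with IsAdmissible S,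
      if k = m - S.card then ∏ e ∈ S, (M e.1 e.2 * (l e.1 : ℝ)) else 0 := by
    intro k
    rw [hD, Polynomial.finsetSum_coeff]
    refine Finset.sum_congr rfl fun S _ => ?_
    rw [← map_prod, mul_comm, Polynomial.coeff_C_mul, Polynomial.coeff_X_pow]
    simp
  constructor
  · rw [hk]
    refine Finset.sum_eq_zero fun S hS => if_neg ?_
    have := (Finset.mem_filter.1 hS).2.card_le
    omega
  · rw [hk, ← Finset.sum_filter, Finset.filter_filter, Amax_eq_sum]
    refine Finset.sum_congr ?_ fun _ _ => rfl
    ext S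
    simp only [admissibleSets, Finset.mem_filter, Finset.mem_univ, true_and]
    constructor
    · rintro ⟨h, h1⟩
      exact ⟨h, by omega⟩
    · rintro ⟨h, h1⟩
      exact ⟨h, by omega⟩

lemma coeff_one_lagrangePolynomial (hm : 0 < m) (l : Fin m →₀ ℕ)
    (M : Matrix (Fin m) (Fin m) ℝ) (hM : ∀ j, linForm M l j ≠ 0) :
    (lagrangePolynomial l M).coeff 1 = unsignedTerm M l := by
  obtain ⟨hD0, hD1⟩ := coeff_det_laplacian hm l M
  have h := prod_linForm_mul_lagrangePolynomial l M
  have h0 := congrArg (fun p => Polynomial.coeff p 0) h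
  have h1 := congrArg (fun p => Polynomial.coeff p 1) h
  simp only [Polynomial.mul_coeff_zero, Polynomial.mul_coeff_one, hD0, hD1, mul_zero,
    add_zero] at h0 h1
  have hL : (∏ i, (Polynomial.X + Polynomial.C (linForm M l i))).coeff 0 =
      ∏ i, linForm M l i := by
    rw [Polynomial.coeff_zero_eq_eval_zero, Polynomial.eval_prod]
    simp
  have hch : (∏ i, Ring.choose (Polynomial.X + Polynomial.C (linForm M l i)) (l i)).coeff 0 =
      ∏ i, Ring.choose (linForm M l i) (l i) := by
    rw [Polynomial.coeff_zero_eq_eval_zero, Polynomial.eval_prod]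
    refine Finset.prod_congr rfl fun i _ => ?_
    have := Ring.map_choose (Polynomial.evalRingHom (0 : ℝ))
      (Polynomial.X + Polynomial.C (linForm M l i)) (l i)
    simpa using this
  have hne : ∏ i, linForm M l i ≠ 0 := Finset.prod_ne_zero_iff.2 fun i _ => hM i
  rw [hL] at h0
  -- The constant term of the Laplacian determinant is 0 and the linear forms are nonzero, so the
  -- Lagrange polynomial has no constant term. Only one product then survives on each side of the
  -- comparison of linear terms.
  have hQ0 := (mul_eq_zero.1 h0).resolve_left hne
  rw [hL, hch, hQ0, mul_zero, add_zero] at h1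
  rw [unsignedTerm, Finset.prod_mul_distrib, Finset.prod_div_distrib, Finset.prod_const_one]
  field_simp
  linear_combination h1

/-! ### Coefficientwise continuity of families of polynomials -/

section Continuity

variable {T : Type*} [TopologicalSpace T]

lemma continuous_coeff_mul {p r : T → Polynomial ℝ} (hp : ∀ k, Continuous fun t => (p t).coeff k)
    (hr : ∀ k, Continuous fun t => (r t).coeff k) (k : ℕ) :
    Continuous fun t => (p t * r t).coeff k := by
  simp only [Polynomial.coeff_mul]
  exact continuous_finsetSum _ fun i _ => (hp _).mul (hr _)

lemma continuous_coeff_prod {ι : Type*} (s : Finset ι) {p : ι → T → Polynomial ℝ}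
    (hp : ∀ i ∈ s, ∀ k, Continuous fun t => (p i t).coeff k) (k : ℕ) :
    Continuous fun t => (∏ i ∈ s, p i t).coeff k := by
  classical
  induction s using Finset.induction_on generalizing k with
  | empty => simpa using continuous_const
  | insert a s ha ih =>
    simp only [Finset.prod_insert ha]
    exact continuous_coeff_mul (hp a (mem_insert_self a s))
      (ih fun i hi => hp i (mem_insert_of_mem hi)) k

/-- Induction on n through the absorption identity, which expresses binom(p, n + 1) by p, binom(p -
1, n) and a division by n + 1. -/
lemma continuous_coeff_choose (n : ℕ) {p : T → Polynomial ℝ}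
    (hp : ∀ k, Continuous fun t => (p t).coeff k) (k : ℕ) :
    Continuous fun t => (Ring.choose (p t) n).coeff k := by
  induction n generalizing p k with
  | zero => simpa using continuous_const
  | succ n ih =>
    have hp' : ∀ k, Continuous fun t => (p t - 1).coeff k := by
      intro k
      simp only [Polynomial.coeff_sub]
      exact (hp k).sub continuous_const
    have e : ∀ t, (Ring.choose (p t) (n + 1)).coeff k =
        (p t * Ring.choose (p t - 1) n).coeff k / ((n + 1 : ℕ) : ℝ) := by
      intro t
      have h := congrArg (fun q => Polynomial.coeff q k) (natCast_mul_choose (p t) (n + 1))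
      simp only [choosePred] at h
      rw [← Polynomial.C_eq_natCast, Polynomial.coeff_C_mul] at h
      rw [← h, mul_div_cancel_left₀]
      exact Nat.cast_ne_zero.2 (Nat.succ_ne_zero n)
    simp only [e]
    exact (continuous_coeff_mul hp (fun k => ih hp' k) k).div_const _

lemma continuous_coeff_choosePred (n : ℕ) {p : T → Polynomial ℝ}
    (hp : ∀ k, Continuous fun t => (p t).coeff k) (k : ℕ) :
    Continuous fun t => (choosePred (p t) n).coeff k := by
  cases n with
  | zero => simpa [choosePred] using continuous_const
  | succ n =>
    refine continuous_coeff_choose n (fun k => ?_) k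
    simp only [Polynomial.coeff_sub]
    exact (hp k).sub continuous_const

end Continuity

lemma continuous_linForm (l : Fin m →₀ ℕ) (j : Fin m) :
    Continuous fun M : Matrix (Fin m) (Fin m) ℝ => linForm M l j := by
  unfold linForm
  exact continuous_finsetSum _ fun i _ => (continuous_id.matrix_elem i j).mul continuous_const

/-- The determinant has no denominators, so continuity also holds at matrices where linear forms
vanish. The limit by continuity is therefore its linear coefficient at C. -/
lemma continuous_coeff_lagrangePolynomial (l : Fin m →₀ ℕ) (k : ℕ) :
    Continuous fun M => (lagrangePolynomial l M).coeff k := by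
  have hC : ∀ {f : Matrix (Fin m) (Fin m) ℝ → ℝ}, Continuous f →
      ∀ k, Continuous fun M => (Polynomial.C (f M)).coeff k := by
    intro f hf k
    simp only [Polynomial.coeff_C]
    split_ifs
    · exact hf
    · exact continuous_const
  have hs : ∀ i k, Continuous fun M : Matrix (Fin m) (Fin m) ℝ =>
      (Polynomial.X + Polynomial.C (linForm M l i)).coeff k := by
    intro i k
    simp only [Polynomial.coeff_add]
    exact continuous_const.add (hC (continuous_linForm l i) k)
  have hentry : ∀ i j k, Continuous fun M : Matrix (Fin m) (Fin m) ℝ =>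
      (lagrangeMatrix (M.map Polynomial.C)
        (fun i => Polynomial.X + Polynomial.C (linForm M l i)) l i j).coeff k := by
    intro i j k
    simp only [lagrangeMatrix, Polynomial.coeff_sub, Matrix.map_apply]
    refine Continuous.sub ?_ (continuous_coeff_mul
      (continuous_coeff_choosePred (l i) (hs i)) (hC (continuous_id.matrix_elem i j)) k)
    split_ifs
    · exact continuous_coeff_choose (l i) (hs i) k
    · exact continuous_const
  unfold lagrangePolynomial
  simp only [Matrix.det_apply, Polynomial.finsetSum_coeff, Polynomial.coeff_smul]
  exact continuous_finsetSum _ fun σ _ =>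
    (continuous_coeff_prod univ (fun i _ => hentry (σ i) i) k).const_smul _

lemma pos_of_ne_zero {l : Fin m →₀ ℕ} (hl : l ≠ 0) : 0 < m := by
  rcases Nat.eq_zero_or_pos m with rfl | h
  · exact absurd (Subsingleton.elim l 0) hl
  · exact h

/-- Adding ε > 0 to every entry of C makes all linear forms positive, because l ≠ 0. This makes the
limit defining the coefficient unique. -/
lemma regularNhds_neBot (C : Matrix (Fin m) (Fin m) ℕ) {l : Fin m →₀ ℕ} (hl : l ≠ 0) :
    (regularNhds C l).NeBot := by
  rw [regularNhds, ← mem_closure_iff_nhdsWithin_neBot]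
  have hcont : Continuous fun ε : ℝ => (Matrix.of fun i j => (C i j : ℝ) + ε) := by
    refine continuous_matrix fun i j => ?_
    exact continuous_const.add continuous_id
  have h0 : Tendsto (fun ε : ℝ => (Matrix.of fun i j => (C i j : ℝ) + ε)) (𝓝[>] 0)
      (𝓝 (realMatrix C)) := by
    have := (hcont.tendsto 0).mono_left (nhdsWithin_le_nhds (s := Set.Ioi 0))
    convert this using 2
    ext i j
    simp
  refine mem_closure_of_tendsto h0 ?_
  filter_upwards [self_mem_nhdsWithin] with ε hε j
  have hε : 0 < ε := hε
  obtain ⟨i, hi⟩ := Finsupp.ne_iff.1 hl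
  have hi : 0 < l i := Nat.pos_of_ne_zero hi
  refine (Finset.sum_pos' (fun k _ => ?_) ⟨i, Finset.mem_univ i, ?_⟩).ne'
  · simp only [Matrix.of_apply]
    positivity
  · simp only [Matrix.of_apply]
    positivity

lemma tendsto_unsignedTerm (C : Matrix (Fin m) (Fin m) ℕ) {l : Fin m →₀ ℕ} (hl : l ≠ 0) :
    Tendsto (fun M => unsignedTerm M l) (regularNhds C l)
      (𝓝 ((lagrangePolynomial l (realMatrix C)).coeff 1)) := by
  have h := ((continuous_coeff_lagrangePolynomial l 1).tendsto (realMatrix C)).mono_left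
    (nhdsWithin_le_nhds (s := {M | ∀ j, linForm M l j ≠ 0}))
  refine h.congr' ?_
  filter_upwards [self_mem_nhdsWithin] with M hM
  exact coeff_one_lagrangePolynomial (pos_of_ne_zero hl) l M hM

lemma logCoeff_eq (C : Matrix (Fin m) (Fin m) ℕ) {l : Fin m →₀ ℕ} (hl : l ≠ 0) :
    logCoeff C l = (-1) ^ signExponent C l * (lagrangePolynomial l (realMatrix C)).coeff 1 := by
  have := regularNhds_neBot C hl
  rw [logCoeff, (tendsto_unsignedTerm C hl).limUnder_eq]

lemma logCoeff_eq_of_ne_zero (C : Matrix (Fin m) (Fin m) ℕ) {l : Fin m →₀ ℕ} (hl : l ≠ 0)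
    (h : ∀ j, ∑ i, C i j * l i ≠ 0) :
    logCoeff C l = (-1) ^ (∑ i, (C i i + 1) * l i) * Amax (realMatrix C) l *
      ∏ j, (1 / ((∑ i, C i j * l i : ℕ) : ℝ) * ((∑ i, C i j * l i).choose (l j) : ℝ)) := by
  have hlin : ∀ j, linForm (realMatrix C) l j = ((∑ i, C i j * l i : ℕ) : ℝ) := by
    intro j
    simp [linForm]
  rw [logCoeff_eq C hl, coeff_one_lagrangePolynomial (pos_of_ne_zero hl), unsignedTerm,
    signExponent, mul_assoc]
  · simp only [hlin, Ring.choose_natCast]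
  · intro j
    rw [hlin]
    exact Nat.cast_ne_zero.2 (h j)

end LogCoefficient

/-! ### Homogeneous parts of the polynomial A -/

section Degree

variable {m : ℕ}

/-- The homogeneous part of degree `k` of the polynomial `A`. -/
noncomputable def admissiblePart (M : Matrix (Fin m) (Fin m) ℝ) (k : ℕ) :
    MvPolynomial (Fin m) ℝ :=
  ∑ S ∈ admissibleSets m k, ∏ p ∈ S, MvPolynomial.C (M p.1 p.2) * MvPolynomial.X p.1

lemma isHomogeneous_admissiblePart (M : Matrix (Fin m) (Fin m) ℝ) (k : ℕ) :
    (admissiblePart M k).IsHomogeneous k := by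
  refine MvPolynomial.IsHomogeneous.sum _ _ _ fun S hS => ?_
  have hcard : S.card = k := by
    simp only [admissibleSets, Finset.mem_filter] at hS
    exact hS.2.2
  have := MvPolynomial.IsHomogeneous.prod S
    (fun p => MvPolynomial.C (M p.1 p.2) * MvPolynomial.X p.1) (fun _ => 1)
    fun p _ => MvPolynomial.isHomogeneous_C_mul_X _ _
  simpa [hcard] using this

lemma admissiblePart_zero (M : Matrix (Fin m) (Fin m) ℝ) : admissiblePart M 0 = 1 := by
  have : admissibleSets m 0 = {∅} := by
    ext S
    simp only [admissibleSets, Finset.mem_filter, Finset.mem_univ, true_and, Finset.card_eq_zero,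
      Finset.mem_singleton]
    constructor
    · exact fun h => h.2
    · rintro rfl
      exact ⟨⟨by simp, fun n f _ hf => absurd (hf 0) (by simp)⟩, rfl⟩
  rw [admissiblePart, this]
  simp

lemma polyA_eq_sum (M : Matrix (Fin m) (Fin m) ℝ) :
    polyA M = ∑ k ∈ range (m - 1 + 1), admissiblePart M k := by
  -- The summand 1 of A is the part for k = 0, coming from the empty set alone.
  rw [Finset.range_eq_Ico, Finset.sum_eq_sum_Ico_succ_bot (by omega), admissiblePart_zero]
  rfl

lemma totalDegree_polyA_le (M : Matrix (Fin m) (Fin m) ℝ) :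
    (polyA M).totalDegree ≤ m - 1 := by
  rw [polyA_eq_sum]
  refine MvPolynomial.totalDegree_finsetSum_le fun k hk => ?_
  have := Finset.mem_range.1 hk
  exact (isHomogeneous_admissiblePart M k).totalDegree_le.trans (by omega)

lemma homogeneousComponent_polyA (M : Matrix (Fin m) (Fin m) ℝ) :
    MvPolynomial.homogeneousComponent (m - 1) (polyA M) = polyAmax M := by
  rw [polyA_eq_sum, map_sum, Finset.sum_eq_single (m - 1)]
  · rw [MvPolynomial.homogeneousComponent_of_mem (isHomogeneous_admissiblePart M (m - 1)),
      if_pos rfl]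
    rfl
  · intro k _ hk
    rw [MvPolynomial.homogeneousComponent_of_mem (isHomogeneous_admissiblePart M k),
      if_neg hk.symm]
  · intro h
    simp at h

end Degree

end SymmetricQuiver

/-! ### The main theorem -/

theorem mainTheorem2 (m : ℕ) (C : Matrix (Fin m) (Fin m) ℕ) (hC : C.IsSymm) :
    -- the classical generating series `y` exists
    (∃ y : MvPowerSeries (Fin m) ℝ,
      SymmetricQuiver.IsClassicalLimit C y ∧
      MvPowerSeries.constantCoeff y = 1 ∧
      -- the formula for its logarithm
      SymmetricQuiver.logSeries y = (fun l => if l = 0 then 0 else SymmetricQuiver.logCoeff C l) ∧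
      -- the numerical Donaldson-Thomas invariants exist and are given by Möbius inversion
      (∃ Ω : {d : Fin m →₀ ℕ // d ≠ 0} → ℤ, SymmetricQuiver.IsDTFamily y Ω) ∧
      (∀ Ω : {d : Fin m →₀ ℕ // d ≠ 0} → ℤ, SymmetricQuiver.IsDTFamily y Ω →
        ∀ d : {d : Fin m →₀ ℕ // d ≠ 0},
          (Ω d : ℝ) = -∑ n ∈ (Finset.univ.gcd d.1).divisors,
            (ArithmeticFunction.moebius n : ℝ) / (n : ℝ) *
              SymmetricQuiver.logCoeff C (SymmetricQuiver.divVec d.1 n))) ∧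
    -- the value by continuity in the formula exists for every nonzero `l`
    (∀ l : Fin m →₀ ℕ, l ≠ 0 →
      (SymmetricQuiver.regularNhds C l).NeBot ∧
      Filter.Tendsto
        (fun M => (-1) ^ SymmetricQuiver.signExponent C l * SymmetricQuiver.unsignedTerm M l)
        (SymmetricQuiver.regularNhds C l) (nhds (SymmetricQuiver.logCoeff C l))) ∧
    -- it is the value of the formula itself wherever no denominator vanishes
    (∀ l : Fin m →₀ ℕ, l ≠ 0 → (∀ j, ∑ i, C i j * l i ≠ 0) →
      SymmetricQuiver.logCoeff C l =
        (-1) ^ (∑ i, (C i i + 1) * l i) *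
          SymmetricQuiver.Amax (C.map (fun n : ℕ => (n : ℝ))) l *
          ∏ j, (1 / ((∑ i, C i j * l i : ℕ) : ℝ) *
            ((∑ i, C i j * l i).choose (l j) : ℝ))) ∧
    -- `m - 1` is the maximal size of an admissible set
    (∀ S : Finset (Fin m × Fin m), SymmetricQuiver.IsAdmissible S → S.card ≤ m - 1) ∧
    (∃ S : Finset (Fin m × Fin m), SymmetricQuiver.IsAdmissible S ∧ S.card = m - 1) ∧
    -- `A` has degree at most `m - 1`, and `A_max` is its homogeneous part of degree `m - 1`
    (SymmetricQuiver.polyA (C.map (fun n : ℕ => (n : ℝ)))).totalDegree ≤ m - 1 ∧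
    MvPolynomial.homogeneousComponent (m - 1)
        (SymmetricQuiver.polyA (C.map (fun n : ℕ => (n : ℝ)))) =
      SymmetricQuiver.polyAmax (C.map (fun n : ℕ => (n : ℝ))) := by
  open SymmetricQuiver in
  have hlog : ∀ l : Fin m →₀ ℕ, l ≠ 0 →
      MvPowerSeries.coeff l (logSeries (limitSeries C fun _ => 1)) = logCoeff C l := by
    intro l hl
    rw [coeff_logSeries_limitSeries C hC, logCoeff_eq C hl]
  have hconst := SymmetricQuiver.constantCoeff_limitSeries C fun _ => 1
  refine ⟨⟨SymmetricQuiver.limitSeries C fun _ => 1,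
    SymmetricQuiver.isClassicalLimit_limitSeries C hC, hconst, ?_,
    SymmetricQuiver.exists_isDTFamily (SymmetricQuiver.mem_integralSeries.2
      (SymmetricQuiver.exists_int_coeff_limitSeries C _)) hconst, ?_⟩, ?_, ?_,
    fun S hS => hS.card_le, SymmetricQuiver.exists_isAdmissible_card m,
    SymmetricQuiver.totalDegree_polyA_le _, SymmetricQuiver.homogeneousComponent_polyA _⟩
  · ext l
    change _ = if l = 0 then 0 else SymmetricQuiver.logCoeff C l
    split_ifs with hl
    -- In degree 0 only the term k = 0 of the logarithm is left, and its coefficient is 0.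
    · rw [hl, SymmetricQuiver.coeff_logSeries hconst]
      simp
    · exact hlog l hl
  · intro Ω hΩ d
    rw [SymmetricQuiver.isDTFamily_eq_moebius_sum hconst hΩ d]
    congr 1
    refine Finset.sum_congr rfl fun n hn => ?_
    rw [hlog _ (SymmetricQuiver.divVec_ne_zero d.2 (Nat.dvd_of_mem_divisors hn))]
  · intro l hl
    refine ⟨SymmetricQuiver.regularNhds_neBot C hl, ?_⟩
    rw [SymmetricQuiver.logCoeff_eq C hl]
    exact (SymmetricQuiver.tendsto_unsignedTerm C hl).const_mul _
  · intro l hl h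
    exact SymmetricQuiver.logCoeff_eq_of_ne_zero C hl h
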